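/- Let $\mathbb{T}=\mathbb{R}\cup\{-\infty\}$. Let $\mathbb{K}$ be a Hardy field whose elements are germs at $+\infty$ of functions $\mathbb{R}\to\mathbb{R}$ definable (with parameters) in a fixed polynomially bounded o-minimal structure on $\mathbb{R}$, and suppose that $\mathbb{K}$ contains $t^r$ for every $r\in\mathbb{R}$. For a germ $f$ put $\operatorname{val} f=\lim_{t\to\infty}\log|f(t)|/\log t$, with $\log 0=-\infty$. For $A\in\mathbb{T}^{d\times m}$, a lift of $A$ is a matrix $\mathbf{A}\in\mathbb{K}^{d\times m}$ with non-negative entries whose entrywise valuation is $A$. Let $\operatorname{vol}\mathbf{A}$ be the germ of $t\mapsto\operatorname{vol}_d\bigl(\operatorname{conv}\mathbf{A}(t)\bigr)$, the $d$-dimensional Lebesgue measure of the convex hull of the columns of $\mathbf{A}(t)$. The upper dequantized tropical volume of $A$ is \[ \operatorname{qvol}^+A=\sup\{\operatorname{val}\operatorname{vol}\mathbf{A} \mid \mathbf{A}\text{ is a lift of }A\}\in[-\infty,\infty]. \] **Corollary.** The function $A\mapsto\operatorname{qvol}^+A$, for matrices $A\in\mathbb{T}^{d\times m}$ of arbitrary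 sizes $d,m$, can be computed in strongly polynomial time. That is, there are an algorithm (a program of a random access machine over the real numbers, with indices in $\mathbb{N}$, real numbers in memory, rational constants, and the elementary operations $+,-,\times,/$ and comparison on real numbers), which does not depend on $\mathbb{K}$, and a polynomial $p$ with natural number coefficients such that: 1. for all $d,m$ and all $A\in\mathbb{T}^{d\times m}$, the algorithm, given $d$, $m$ and $A$, halts with output $\operatorname{qvol}^+A\in\mathbb{T}$ after at most $p(d+m)$ steps; 2. all indices that occur in the computation are at most $p(d+m)$; 3. if the finite entries of $A$ are rational, then all numbers that occur in the computation are rational, with binary encoding length at most $p(N)$, where $N$ is the binary encoding length of the input $(d,m,A)$, with $d$ and $m$ counted in unary. -/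

import Mathlib

open Filter Topology MeasureTheory

universe u v

namespace TropVol

/-! ### Hardy fields of germs definable in an o-minimal structure -/

/-- A subset of the real line is definable in the structure `L` on `ℝ` (with real parameters). -/
def DefinableSet (L : FirstOrder.Language.{u, v}) [L.Structure ℝ] (s : Set ℝ) : Prop :=
  (Set.univ : Set ℝ).Definable₁ L s

/-- A function `ℝ → ℝ` is definable (with real parameters) if its graph is. -/
def DefinableFunction (L : FirstOrder.Language.{u, v}) [L.Structure ℝ] (f : ℝ → ℝ) : Prop :=
  (Set.univ : Set ℝ).Definable₂ L {p : ℝ × ℝ | f p.1 = p.2}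

/-- `L` is an o-minimal structure on the ordered set `(ℝ, <)`: the order is definable, and every
definable subset of `ℝ` is a finite union of intervals (an order-connected subset of `ℝ` is an
interval, possibly empty, degenerate to a point, or unbounded). -/
structure IsOMinimal (L : FirstOrder.Language.{u, v}) [L.Structure ℝ] : Prop where
  lt_definable : (Set.univ : Set ℝ).Definable₂ L {p : ℝ × ℝ | p.1 < p.2}
  finite_union : ∀ s : Set ℝ, DefinableSet L s →
    ∃ F : Set (Set ℝ), F.Finite ∧ (∀ I ∈ F, I.OrdConnected) ∧ s = ⋃₀ F

/-- Every definable function is bounded by a power of `t` as `t → ∞`. -/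
def IsPolynomiallyBounded (L : FirstOrder.Language.{u, v}) [L.Structure ℝ] : Prop :=
  ∀ f : ℝ → ℝ, DefinableFunction L f → ∃ n : ℕ, ∀ᶠ t in atTop, |f t| ≤ t ^ n

/-- A Hardy field: a field of germs at `+∞` of real functions, whose elements are eventually
differentiable, and which is closed under differentiation. -/
structure IsHardyField (K : Subring (Germ (atTop : Filter ℝ) ℝ)) : Prop where
  isField : IsField K
  differentiable : ∀ f : ℝ → ℝ, (f : Germ (atTop : Filter ℝ) ℝ) ∈ K →
    ∀ᶠ t in atTop, DifferentiableAt ℝ f t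
  deriv_mem : ∀ f : ℝ → ℝ, (f : Germ (atTop : Filter ℝ) ℝ) ∈ K →
    (deriv f : Germ (atTop : Filter ℝ) ℝ) ∈ K

/-- `K` is a Hardy field which consists of germs of functions definable in the structure `L`, where
`L` is o-minimal and polynomially bounded, and which contains all real powers of `t`. -/
structure IsDefinableHardyField (L : FirstOrder.Language.{u, v}) [L.Structure ℝ]
    (K : Subring (Germ (atTop : Filter ℝ) ℝ)) : Prop where
  oMinimal : IsOMinimal L
  polynomiallyBounded : IsPolynomiallyBounded L
  hardyField : IsHardyField K
  definable : ∀ g ∈ K, ∃ f : ℝ → ℝ, DefinableFunction L f ∧ (f : Germ (atTop : Filter ℝ) ℝ) = g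
  rpow_mem : ∀ r : ℝ, ((fun t : ℝ => t ^ r : ℝ → ℝ) : Germ (atTop : Filter ℝ) ℝ) ∈ K

/-! ### The upper dequantized tropical volume -/

/-- The inclusion of the tropical numbers `ℝ ∪ {-∞}` into the extended real line. -/
noncomputable def toEReal : WithBot ℝ → EReal :=
  WithBot.recBotCoe ⊥ (fun x : ℝ => (x : EReal))

/-- The valuation of (the germ at `+∞` of) `f` is `v`, i.e.
`log |f t| / log t → v` as `t → ∞`, where `log 0 = -∞`. -/
def HasVal (f : ℝ → ℝ) (v : EReal) : Prop :=
  Tendsto (fun t : ℝ => ENNReal.log (ENNReal.ofReal |f t|) / (Real.log t : EReal)) atTop (𝓝 v)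

/-- The matrix `a` of functions represents a lift of the tropical matrix `A`: a matrix with
non-negative entries in `K` whose entrywise valuation is `A`. -/
structure IsLift (K : Subring (Germ (atTop : Filter ℝ) ℝ)) {d m : ℕ}
    (A : Matrix (Fin d) (Fin m) (WithBot ℝ)) (a : Fin d → Fin m → ℝ → ℝ) : Prop where
  mem : ∀ i j, (a i j : Germ (atTop : Filter ℝ) ℝ) ∈ K
  nonneg : ∀ i j, ∀ᶠ t in atTop, 0 ≤ a i j t
  val : ∀ i j, HasVal (a i j) (toEReal (A i j))

/-- The volume of the convex hull of the columns of `a`, as a function of `t`: at `t`, the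
`d`-dimensional Lebesgue measure of the convex hull of the columns of `a(t)`. -/
noncomputable def volConv {d m : ℕ} (a : Fin d → Fin m → ℝ → ℝ) (t : ℝ) : ℝ :=
  volume.real (convexHull ℝ (Set.range fun (j : Fin m) => (fun (i : Fin d) => a i j t)))

/-- The upper dequantized tropical volume of `A`: the supremum of `val (vol a)` over all lifts `a`
of `A`. -/
noncomputable def qvolPlus (K : Subring (Germ (atTop : Filter ℝ) ℝ)) {d m : ℕ}
    (A : Matrix (Fin d) (Fin m) (WithBot ℝ)) : EReal :=
  sSup {w : EReal | ∃ a : Fin d → Fin m → ℝ → ℝ, IsLift K A a ∧ HasVal (volConv a) w}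

/-! ### A random access machine over the real numbers

The memory consists of index variables and arrays of indices (natural numbers), and arrays of real
numbers.  Real numbers can be combined by the elementary operations `+`, `-`, `*`, `/` and
compared; they cannot be turned into indices. -/

/-- The memory of the machine. Variables and arrays are named by natural numbers. -/
structure Store where
  /-- index variables -/
  var : ℕ → ℕ
  /-- arrays of indices -/
  cell : ℕ → ℕ → ℕ
  /-- arrays of real numbers -/
  num : ℕ → ℕ → ℝ

/-- Index expressions: constants, variables, cells of index arrays, sum, truncated difference and
product. -/
inductive IndexExpr where
  | const (n : ℕ)
  | var (x : ℕ)
  | cell (a : ℕ) (e : IndexExpr)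
  | add (e₁ e₂ : IndexExpr)
  | sub (e₁ e₂ : IndexExpr)
  | mul (e₁ e₂ : IndexExpr)

/-- The value of an index expression. -/
def IndexExpr.eval (s : Store) : IndexExpr → ℕ
  | const n => n
  | var x => s.var x
  | cell a e => s.cell a (e.eval s)
  | add e₁ e₂ => e₁.eval s + e₂.eval s
  | sub e₁ e₂ => e₁.eval s - e₂.eval s
  | mul e₁ e₂ => e₁.eval s * e₂.eval s

/-- Tests: comparison of two indices, of two real cells, and boolean combinations. -/
inductive Test where
  | indexLT (e₁ e₂ : IndexExpr)
  | numLE (a : ℕ) (e₁ : IndexExpr) (b : ℕ) (e₂ : IndexExpr)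
  | neg (b : Test)
  | both (b₁ b₂ : Test)

/-- The outcome of a test. -/
def Test.Holds (s : Store) : Test → Prop
  | indexLT e₁ e₂ => e₁.eval s < e₂.eval s
  | numLE a e₁ b e₂ => s.num a (e₁.eval s) ≤ s.num b (e₂.eval s)
  | neg b => ¬ b.Holds s
  | both b₁ b₂ => b₁.Holds s ∧ b₂.Holds s

/-- The elementary arithmetic operations on real numbers. -/
inductive NumOp where
  | add
  | sub
  | mul
  | div

/-- The value of an elementary operation (a division by zero returns zero). -/
noncomputable def NumOp.eval : NumOp → ℝ → ℝ → ℝ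
  | add, x, y => x + y
  | sub, x, y => x - y
  | mul, x, y => x * y
  | div, x, y => x / y

/-- Programs. -/
inductive Program where
  | skip
  /-- `x := e` for an index variable `x` -/
  | setVar (x : ℕ) (e : IndexExpr)
  /-- `a[e₁] := e₂` for an array `a` of indices -/
  | setCell (a : ℕ) (e₁ e₂ : IndexExpr)
  /-- `a[e] := q` for an array `a` of real numbers and a rational constant `q` -/
  | setConst (a : ℕ) (e : IndexExpr) (q : ℚ)
  /-- `a[e] := b[e₁]` for arrays `a`, `b` of real numbers -/
  | copyNum (a : ℕ) (e : IndexExpr) (b : ℕ) (e₁ : IndexExpr)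
  /-- `a[e] := b[e₁] op c[e₂]` for arrays `a`, `b`, `c` of real numbers -/
  | setNum (op : NumOp) (a : ℕ) (e : IndexExpr) (b : ℕ) (e₁ : IndexExpr)
      (c : ℕ) (e₂ : IndexExpr)
  | seq (c₁ c₂ : Program)
  /-- if `b` then `c₁` else `c₂` -/
  | cond (b : Test) (c₁ c₂ : Program)
  /-- while `b` do `c` -/
  | loop (b : Test) (c : Program)

/-- The store after `a[i] := n` for an array of indices. -/
def Store.writeCell (s : Store) (a i n : ℕ) : Store :=
  { s with cell := Function.update s.cell a (Function.update (s.cell a) i n) }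

/-- The store after `a[i] := x` for an array of real numbers. -/
def Store.writeNum (s : Store) (a i : ℕ) (x : ℝ) : Store :=
  { s with num := Function.update s.num a (Function.update (s.num a) i x) }

open Classical in
/-- One step of the machine. A configuration consists of the list of programs that remain to be
executed and the current store; the machine has halted when nothing remains. A step executes one
assignment or one test, or unfolds one sequential composition. Since the expressions in a given
program have bounded length, a step amounts to a bounded number of elementary operations. -/
noncomputable def step : List Program × Store → List Program × Store
  | ([], s) => ([], s)
  | (.skip :: k, s) => (k, s)
  | (.setVar x e :: k, s) => (k, { s with var := Function.update s.var x (e.eval s) })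
  | (.setCell a e₁ e₂ :: k, s) => (k, s.writeCell a (e₁.eval s) (e₂.eval s))
  | (.setConst a e q :: k, s) => (k, s.writeNum a (e.eval s) (q : ℝ))
  | (.copyNum a e b e₁ :: k, s) => (k, s.writeNum a (e.eval s) (s.num b (e₁.eval s)))
  | (.setNum op a e b e₁ c e₂ :: k, s) =>
      (k, s.writeNum a (e.eval s) (op.eval (s.num b (e₁.eval s)) (s.num c (e₂.eval s))))
  | (.seq c₁ c₂ :: k, s) => (c₁ :: c₂ :: k, s)
  | (.cond b c₁ c₂ :: k, s) => ((if b.Holds s then c₁ else c₂) :: k, s)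
  | (.loop b c :: k, s) => (if b.Holds s then c :: .loop b c :: k else k, s)

/-- The configuration after `t` steps of the program `P`, started in the store `s`. -/
noncomputable def run (P : Program) (s : Store) (t : ℕ) : List Program × Store :=
  step^[t] ([P], s)

/-! ### Strongly polynomial time for functions of tropical matrices -/

/-- The entries of a tropical `d × m` matrix, listed row by row (`A i j` in position `i * m + j`),
followed by `-∞`. -/
def entry {d m : ℕ} (A : Matrix (Fin d) (Fin m) (WithBot ℝ)) (k : ℕ) : WithBot ℝ :=
  if h : k < d * m then
    A (finProdFinEquiv.symm ⟨k, h⟩).1 (finProdFinEquiv.symm ⟨k, h⟩).2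
  else ⊥

open Classical in
/-- The input store for `A`: the index variables `0` and `1` hold `d` and `m`; the entry `A i j` is
in position `i * m + j`, where the index array `0` holds `1` if the entry is finite and `0` if it is
`-∞`, and the number array `0` holds the entry if it is finite. All other memory is zero. -/
noncomputable def input {d m : ℕ} (A : Matrix (Fin d) (Fin m) (WithBot ℝ)) : Store where
  var x := if x = 0 then d else if x = 1 then m else 0
  cell a k := if a = 0 ∧ entry A k ≠ ⊥ then 1 else 0
  num a k := if a = 0 then (entry A k).unbotD 0 else 0

/-- The tropical number which a store represents as its output: `-∞` if the first cell of the index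
array `1` is zero, and the first cell of the number array `1` otherwise. -/
noncomputable def output (s : Store) : WithBot ℝ :=
  if s.cell 1 0 = 0 then ⊥ else (s.num 1 0 : WithBot ℝ)

/-- The binary encoding length of a rational number. -/
def bitSize (q : ℚ) : ℕ := Nat.size q.num.natAbs + Nat.size q.den

/-- The binary encoding length of an element of `ℚ ∪ {-∞}`. -/
def tropBitSize : WithBot ℚ → ℕ := WithBot.recBotCoe 1 bitSize

/-- The binary encoding length of a `d × m` matrix over `ℚ ∪ {-∞}`. -/
def inputSize {d m : ℕ} (B : Matrix (Fin d) (Fin m) (WithBot ℚ)) : ℕ :=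
  d + m + ∑ i, ∑ j, tropBitSize (B i j)

/-- The program `P` computes the function `f` of tropical matrices in strongly polynomial time:
* on every input `A`, it halts with output `f A` after a number of steps which is bounded by a
  polynomial in the dimensions `d` and `m`, irrespective of the entries;
* all indices which occur in the computation are bounded by a polynomial in `d` and `m`;
* if the finite entries of the input are rational, then all numbers which occur in the computation
  are rational, and their encoding lengths are bounded by a polynomial in that of the input. -/
def Program.ComputesInStronglyPolynomialTime (P : Program)
    (f : ∀ d m : ℕ, Matrix (Fin d) (Fin m) (WithBot ℝ) → EReal) : Prop :=
  ∃ p : Polynomial ℕ,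
    (∀ (d m : ℕ) (A : Matrix (Fin d) (Fin m) (WithBot ℝ)),
      ∃ t ≤ p.eval (d + m), (run P (input A) t).1 = [] ∧
        toEReal (output (run P (input A) t).2) = f d m A) ∧
    (∀ (d m : ℕ) (A : Matrix (Fin d) (Fin m) (WithBot ℝ)) (t : ℕ),
      (∀ x, (run P (input A) t).2.var x ≤ p.eval (d + m)) ∧
        ∀ a k, (run P (input A) t).2.cell a k ≤ p.eval (d + m)) ∧
    (∀ (d m : ℕ) (B : Matrix (Fin d) (Fin m) (WithBot ℚ)) (t a k : ℕ),
      ∃ q : ℚ, (run P (input (B.map (WithBot.map (fun x : ℚ => (x : ℝ))))) t).2.num a k = q ∧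
        bitSize q ≤ p.eval (inputSize B))

end TropVol

/-! For $d<m$ the upper dequantized volume is the value of an assignment problem: the maximum of
$\sum_i A_{i,f(i)}$ over injections $f$ from rows to columns. For $d\ge m$ it is $-\infty$.

Upper bound: by Carathéodory the convex hull is covered by simplices on $d+1$ columns. The volume of
such a simplex is at most the absolute determinant of these columns with a row of ones added. A
repeated column makes the determinant vanish; otherwise every Leibniz term is a signed product along
an injection. So the volume of a lift is at most a constant times the largest such product
(`volume_convexHull_le_of_prod_le`, `IsLift.val_volConv_le`).

Lower bound: take the monomial lift with coefficient $(d+1)!$ on an optimal injection and $1$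
elsewhere, and add one column outside the injection, which exists as $d<m$. The identity term of the
determinant then outweighs all others together, so nothing cancels and the bound is attained
(`qvolPlus_eq_coe`).

The assignment problem is solved by the Hungarian method on an $m\times m$ matrix of slacks, with
zero rows as padding and a large finite slack in place of $-\infty$ (`sum_le_of_slack_le`). Slacks
stay non-negative and change the weight of all permutations by the same amount (`IsSlack.change`),
so a perfect matching of zero slack is optimal (`IsMatching.exists_perm`). Rows are matched one at a
time: an alternating tree grows along pairs of zero slack (`IsTree.grow`) until it reaches a free
column, and the path to the root is then flipped (`IsAugmentation.next`).

Complexity: no loop iterates more than $(d+m+1)^2$ times, so the fixed nesting of loops gives a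
polynomial time bound. Stored indices grow by at most one per step. Numbers are only added and
subtracted, so a common denominator of the input persists and absolute values at most double per
step; hence bit lengths grow linearly in time (`computesInStronglyPolynomialTime_of_isTame`). -/

namespace TropVol

/-! ### Execution of programs -/

/-- The program `P` takes the store `s` to the store `s'` in `n` steps. -/
def Exec (P : Program) (s s' : Store) (n : ℕ) : Prop :=
  ∀ k, step^[n] (P :: k, s) = (k, s')

/-- A syntactic time bound, valid if no loop is iterated more than `(n + 1) ^ 2` times. -/
noncomputable def Program.timeBound : Program → Polynomial ℕ
  | .seq c₁ c₂ => 1 + c₁.timeBound + c₂.timeBound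
  | .cond _ c₁ c₂ => 1 + c₁.timeBound + c₂.timeBound
  | .loop _ c => (Polynomial.X + 1) ^ 2 * (1 + c.timeBound) + 1
  | _ => 1

/-- Index variables assigned by a program. -/
def Program.varWrites : Program → List ℕ
  | .setVar x _ => [x]
  | .seq c₁ c₂ => c₁.varWrites ++ c₂.varWrites
  | .cond _ c₁ c₂ => c₁.varWrites ++ c₂.varWrites
  | .loop _ c => c.varWrites
  | _ => []

/-- Index arrays written by a program. -/
def Program.cellWrites : Program → List ℕ
  | .setCell a _ _ => [a]
  | .seq c₁ c₂ => c₁.cellWrites ++ c₂.cellWrites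
  | .cond _ c₁ c₂ => c₁.cellWrites ++ c₂.cellWrites
  | .loop _ c => c.cellWrites
  | _ => []

/-- Number arrays written by a program. -/
def Program.numWrites : Program → List ℕ
  | .setConst a _ _ => [a]
  | .copyNum a _ _ _ => [a]
  | .setNum _ a _ _ _ _ _ => [a]
  | .seq c₁ c₂ => c₁.numWrites ++ c₂.numWrites
  | .cond _ c₁ c₂ => c₁.numWrites ++ c₂.numWrites
  | .loop _ c => c.numWrites
  | _ => []

/-- The stores `s` and `s'` differ only in places which `P` writes. -/
structure Frame (P : Program) (s s' : Store) : Prop where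
  var : ∀ x, x ∉ P.varWrites → s'.var x = s.var x
  cell : ∀ a, a ∉ P.cellWrites → s'.cell a = s.cell a
  num : ∀ a, a ∉ P.numWrites → s'.num a = s.num a

theorem Frame.refl (P : Program) (s : Store) : Frame P s s :=
  ⟨fun _ _ => rfl, fun _ _ => rfl, fun _ _ => rfl⟩

theorem Frame.trans {P : Program} {s₁ s₂ s₃ : Store} (h : Frame P s₁ s₂) (h' : Frame P s₂ s₃) :
    Frame P s₁ s₃ :=
  ⟨fun x hx => (h'.var x hx).trans (h.var x hx), fun x hx => (h'.cell x hx).trans (h.cell x hx),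
    fun x hx => (h'.num x hx).trans (h.num x hx)⟩

theorem Frame.mono {P P' : Program} {s s' : Store} (h : Frame P s s')
    (hv : P.varWrites ⊆ P'.varWrites) (hc : P.cellWrites ⊆ P'.cellWrites)
    (hn : P.numWrites ⊆ P'.numWrites) : Frame P' s s' :=
  ⟨fun x hx => h.var x fun h => hx (hv h), fun x hx => h.cell x fun h => hx (hc h),
    fun x hx => h.num x fun h => hx (hn h)⟩

/-- Within the time bound for `n`, the program `P` takes `s` to a store with the property `Q`, and
it changes nothing which it does not write. -/
def WP (n : ℕ) (P : Program) (s : Store) (Q : Store → Prop) : Prop :=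
  ∃ s' t, t ≤ P.timeBound.eval n ∧ Exec P s s' t ∧ Frame P s s' ∧ Q s'

/-- Since the frame is handed to the consequence, a specification has to mention only what the
program changes. -/
theorem WP.mono {n : ℕ} {P : Program} {s : Store} {Q Q' : Store → Prop} (h : WP n P s Q)
    (hQ : ∀ s', Frame P s s' → Q s' → Q' s') : WP n P s Q' := by
  obtain ⟨s', t, ht, he, hf, hq⟩ := h
  exact ⟨s', t, ht, he, hf, hQ s' hf hq⟩

theorem Exec.seq {c₁ c₂ : Program} {s s₁ s₂ : Store} {n₁ n₂ : ℕ} (h₁ : Exec c₁ s s₁ n₁)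
    (h₂ : Exec c₂ s₁ s₂ n₂) : Exec (.seq c₁ c₂) s s₂ (1 + n₁ + n₂) := by
  intro k
  rw [show 1 + n₁ + n₂ = n₂ + (n₁ + 1) by ring, Function.iterate_add_apply,
    Function.iterate_succ_apply]
  exact (congrArg _ (h₁ (c₂ :: k))).trans (h₂ k)

theorem WP.seq {n : ℕ} {c₁ c₂ : Program} {s : Store} {Q : Store → Prop}
    (h : WP n c₁ s fun s₁ => WP n c₂ s₁ Q) : WP n (.seq c₁ c₂) s Q := by
  obtain ⟨s₁, t₁, ht₁, he₁, hf₁, s₂, t₂, ht₂, he₂, hf₂, hq⟩ := h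
  refine ⟨s₂, 1 + t₁ + t₂, ?_, he₁.seq he₂, ?_, hq⟩
  · simp only [Program.timeBound, Polynomial.eval_add, Polynomial.eval_one]
    omega
  · exact (hf₁.mono (List.subset_append_left _ _) (List.subset_append_left _ _)
      (List.subset_append_left _ _)).trans (hf₂.mono (List.subset_append_right _ _)
      (List.subset_append_right _ _) (List.subset_append_right _ _))

theorem WP.cond {n : ℕ} {b : Test} {c₁ c₂ : Program} {s : Store} {Q : Store → Prop}
    (h₁ : b.Holds s → WP n c₁ s Q) (h₂ : ¬ b.Holds s → WP n c₂ s Q) :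
    WP n (.cond b c₁ c₂) s Q := by
  by_cases hb : b.Holds s
  · obtain ⟨s', t, ht, he, hf, hq⟩ := h₁ hb
    refine ⟨s', t + 1, ?_, fun k => ?_, ?_, hq⟩
    · simp only [Program.timeBound, Polynomial.eval_add, Polynomial.eval_one]
      omega
    · rw [Function.iterate_succ_apply]
      simpa [step, hb] using he k
    · exact hf.mono (List.subset_append_left _ _) (List.subset_append_left _ _)
        (List.subset_append_left _ _)
  · obtain ⟨s', t, ht, he, hf, hq⟩ := h₂ hb
    refine ⟨s', t + 1, ?_, fun k => ?_, ?_, hq⟩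
    · simp only [Program.timeBound, Polynomial.eval_add, Polynomial.eval_one]
      omega
    · rw [Function.iterate_succ_apply]
      simpa [step, hb] using he k
    · exact hf.mono (List.subset_append_right _ _) (List.subset_append_right _ _)
        (List.subset_append_right _ _)

/-- The loop rule: the invariant `I` is indexed by the number of iterations already done, which is
bounded by `N`. -/
theorem WP.loop {n : ℕ} {b : Test} {c : Program} {s : Store} {Q : Store → Prop}
    (I : ℕ → Store → Prop) (N : ℕ) (hN : N ≤ (n + 1) ^ 2) (h₀ : I 0 s)
    (hstep : ∀ i s', Frame c s s' → I i s' → b.Holds s' → i < N ∧ WP n c s' (I (i + 1)))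
    (hend : ∀ i s', Frame c s s' → I i s' → ¬ b.Holds s' → Q s') :
    WP n (.loop b c) s Q := by
  -- Induction on the number `r` of iterations still allowed; the final `+ 1` pays for the failing
  -- test.
  have main : ∀ r i s', N = i + r → Frame c s s' → I i s' →
      ∃ s'' t, t ≤ r * (1 + c.timeBound.eval n) + 1 ∧ Exec (.loop b c) s' s'' t ∧
        Frame c s s'' ∧ Q s'' := by
    intro r
    induction r with
    | zero =>
      intro i s' hi hf hI
      by_cases hb : b.Holds s'
      · exact absurd (hstep i s' hf hI hb).1 (by omega)
      · exact ⟨s', 1, by omega, fun k => by simp [step, hb], hf, hend i s' hf hI hb⟩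
    | succ r ih =>
      intro i s' hi hf hI
      by_cases hb : b.Holds s'
      · obtain ⟨-, s₁, t₁, ht₁, he₁, hf₁, hI₁⟩ := hstep i s' hf hI hb
        obtain ⟨s₂, t₂, ht₂, he₂, hf₂, hq⟩ := ih (i + 1) s₁ (by omega) (hf.trans hf₁) hI₁
        refine ⟨s₂, t₂ + (t₁ + 1), ?_, fun k => ?_, hf₂, hq⟩
        · rw [Nat.add_mul]
          omega
        · rw [Function.iterate_add_apply, Function.iterate_succ_apply]
          have : step (.loop b c :: k, s') = (c :: .loop b c :: k, s') := by simp [step, hb]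
          rw [this, he₁]
          exact he₂ k
      · exact ⟨s', 1, by omega, fun k => by simp [step, hb], hf, hend i s' hf hI hb⟩
  obtain ⟨s', t, ht, he, hf, hq⟩ := main N 0 s (by omega) (Frame.refl _ _) h₀
  refine ⟨s', t, ht.trans ?_, he, hf.mono (fun _ h => h) (fun _ h => h) (fun _ h => h), hq⟩
  simp only [Program.timeBound, Polynomial.eval_add, Polynomial.eval_one, Polynomial.eval_mul,
    Polynomial.eval_pow, Polynomial.eval_X]
  gcongr

/-- The program contains no loop. -/
def Program.isLoopFree : Program → Bool
  | .seq c₁ c₂ => c₁.isLoopFree && c₂.isLoopFree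
  | .cond _ c₁ c₂ => c₁.isLoopFree && c₂.isLoopFree
  | .loop _ _ => false
  | _ => true

open Classical in
/-- The effect of a program without loops. -/
noncomputable def Program.effect : Program → Store → Store
  | .skip, s => s
  | .setVar x e, s => { s with var := Function.update s.var x (e.eval s) }
  | .setCell a e₁ e₂, s => s.writeCell a (e₁.eval s) (e₂.eval s)
  | .setConst a e q, s => s.writeNum a (e.eval s) (q : ℝ)
  | .copyNum a e b e₁, s => s.writeNum a (e.eval s) (s.num b (e₁.eval s))
  | .setNum op a e b e₁ c e₂, s =>
      s.writeNum a (e.eval s) (op.eval (s.num b (e₁.eval s)) (s.num c (e₂.eval s)))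
  | .seq c₁ c₂, s => c₂.effect (c₁.effect s)
  | .cond b c₁ c₂, s => if b.Holds s then c₁.effect s else c₂.effect s
  | .loop _ _, s => s

/-- Without loops the final store is an explicit function of the initial one, so such specifications
reduce to computation. -/
theorem WP.of_effect {n : ℕ} {P : Program} {s : Store} {Q : Store → Prop} (hP : P.isLoopFree)
    (h : Q (P.effect s)) : WP n P s Q := by
  induction P generalizing s Q with
  | skip => exact ⟨s, 1, by simp [Program.timeBound], fun k => rfl, Frame.refl _ _, h⟩
  | setVar x e =>
    refine ⟨_, 1, by simp [Program.timeBound], fun k => rfl, ⟨fun y hy => ?_, fun _ _ => rfl,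
      fun _ _ => rfl⟩, h⟩
    exact Function.update_of_ne (by simpa [Program.varWrites] using hy) _ _
  | setCell a e₁ e₂ =>
    refine ⟨_, 1, by simp [Program.timeBound], fun k => rfl, ⟨fun _ _ => rfl, fun y hy => ?_,
      fun _ _ => rfl⟩, h⟩
    exact Function.update_of_ne (by simpa [Program.cellWrites] using hy) _ _
  | setConst a e q =>
    refine ⟨_, 1, by simp [Program.timeBound], fun k => rfl, ⟨fun _ _ => rfl, fun _ _ => rfl,
      fun y hy => ?_⟩, h⟩
    exact Function.update_of_ne (by simpa [Program.numWrites] using hy) _ _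
  | copyNum a e b e₁ =>
    refine ⟨_, 1, by simp [Program.timeBound], fun k => rfl, ⟨fun _ _ => rfl, fun _ _ => rfl,
      fun y hy => ?_⟩, h⟩
    exact Function.update_of_ne (by simpa [Program.numWrites] using hy) _ _
  | setNum op a e b e₁ c e₂ =>
    refine ⟨_, 1, by simp [Program.timeBound], fun k => rfl, ⟨fun _ _ => rfl, fun _ _ => rfl,
      fun y hy => ?_⟩, h⟩
    exact Function.update_of_ne (by simpa [Program.numWrites] using hy) _ _
  | seq c₁ c₂ ih₁ ih₂ =>
    simp only [Program.isLoopFree, Bool.and_eq_true] at hP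
    exact WP.seq (ih₁ hP.1 (ih₂ hP.2 h))
  | cond b c₁ c₂ ih₁ ih₂ =>
    simp only [Program.isLoopFree, Bool.and_eq_true] at hP
    refine WP.cond (fun hb => ih₁ hP.1 ?_) (fun hb => ih₂ hP.2 ?_)
    · simpa [Program.effect, hb] using h
    · simpa [Program.effect, hb] using h
  | loop b c => simp [Program.isLoopFree] at hP

/-- `for x = 0, …, e - 1 do c`. -/
def Program.for (x : ℕ) (e : IndexExpr) (c : Program) : Program :=
  .seq (.setVar x (.const 0))
    (.loop (.indexLT (.var x) e) (.seq c (.setVar x (.add (.var x) (.const 1)))))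

/-- The store after `x := i`. -/
def Store.writeVar (s : Store) (x i : ℕ) : Store :=
  { s with var := Function.update s.var x i }

theorem WP.for {n x : ℕ} {e : IndexExpr} {c : Program} {s : Store} {Q : Store → Prop}
    (I : ℕ → Store → Prop) (N : ℕ) (hN : N ≤ (n + 1) ^ 2) (hx : x ∉ c.varWrites)
    (he : ∀ s', Frame (.for x e c) s s' → e.eval s' = N) (h₀ : I 0 (s.writeVar x 0))
    (hstep : ∀ i s', i < N → Frame (.for x e c) s s' → s'.var x = i → I i s' →
      WP n c s' fun s'' => I (i + 1) (s''.writeVar x (i + 1)))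
    (hend : ∀ s', Frame (.for x e c) s s' → s'.var x = N → I N s' → Q s') :
    WP n (.for x e c) s Q := by
  refine WP.seq (WP.of_effect rfl ?_)
  have hf₀ : Frame (.for x e c) s (s.writeVar x 0) :=
    ⟨fun y hy => Function.update_of_ne (by
      rintro rfl
      exact hy (by simp [Program.for, Program.varWrites])) _ _, fun _ _ => rfl, fun _ _ => rfl⟩
  have hf : ∀ s', Frame (.seq c (.setVar x (.add (.var x) (.const 1)))) (s.writeVar x 0) s' →
      Frame (.for x e c) s s' := fun s' h =>
    hf₀.trans (h.mono (List.subset_append_right _ _) (List.subset_append_right _ _)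
      (List.subset_append_right _ _))
  -- The bound `i ≤ N` is part of the invariant so that the failing test forces `i = N` at the end.
  refine WP.loop (fun i s' => i ≤ N ∧ s'.var x = i ∧ I i s') N hN
    ⟨Nat.zero_le _, by simp [Program.effect, IndexExpr.eval], h₀⟩ ?_ ?_
  · rintro i s' hfs ⟨-, hi, hI⟩ hb
    have hlt : i < N := by
      simpa [Test.Holds, IndexExpr.eval, hi, he s' (hf s' hfs)] using hb
    refine ⟨hlt, WP.seq ((hstep i s' hlt (hf s' hfs) hi hI).mono fun s₁ hf₁ h₁ => ?_)⟩
    have hx₁ : s₁.var x = i := (hf₁.var x hx).trans hi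
    refine WP.of_effect rfl ⟨hlt, by simp [Program.effect, IndexExpr.eval, hx₁], ?_⟩
    simpa [Program.effect, IndexExpr.eval, hx₁, Store.writeVar] using h₁
  · rintro i s' hfs ⟨hi', hi, hI⟩ hb
    have hle : N ≤ i := by
      simpa [Test.Holds, IndexExpr.eval, hi, he s' (hf s' hfs)] using hb
    obtain rfl : i = N := le_antisymm hi' hle
    exact hend s' (hf s' hfs) hi hI

/-! ### Bounds on the indices and numbers in a computation -/

/-- Index expressions whose value exceeds the indices in the store by at most one. -/
def IndexExpr.isTame : IndexExpr → Bool
  | .const n => n ≤ 1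
  | .var _ => true
  | .cell _ _ => true
  | .add (.var _) (.const n) => n ≤ 1
  | .sub (.cell _ _) _ => true
  | _ => false

/-- Programs which increase indices by at most one at a time, and which combine numbers by addition
and subtraction only. -/
def Program.isTame : Program → Bool
  | .skip => true
  | .setVar _ e => e.isTame
  | .setCell _ _ e => e.isTame
  | .setConst _ _ q => q = 0 ∨ q = 1
  | .copyNum _ _ _ _ => true
  | .setNum .add _ _ _ _ _ _ => true
  | .setNum .sub _ _ _ _ _ _ => true
  | .setNum _ _ _ _ _ _ _ => false
  | .seq c₁ c₂ => c₁.isTame && c₂.isTame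
  | .cond _ c₁ c₂ => c₁.isTame && c₂.isTame
  | .loop _ c => c.isTame

/-- All indices in the store are at most `B`. -/
def Store.IndexBound (s : Store) (B : ℕ) : Prop :=
  (∀ x, s.var x ≤ B) ∧ ∀ a k, s.cell a k ≤ B

/-- All numbers in the store are of absolute value at most `M` and are fractions with
denominator `D`. -/
def Store.NumBound (s : Store) (D M : ℕ) : Prop :=
  ∀ a k, |s.num a k| ≤ M ∧ ∃ z : ℤ, s.num a k * D = z

/-- Tameness restricts stored values only. Products such as $im+j$ serve as addresses and never
enter the memory, so they do not affect the bound. -/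
theorem IndexExpr.eval_le_of_isTame {e : IndexExpr} (he : e.isTame) {s : Store} {B : ℕ}
    (h : s.IndexBound B) : e.eval s ≤ B + 1 := by
  unfold IndexExpr.isTame at he
  split at he
  · have := of_decide_eq_true he
    simp only [IndexExpr.eval]
    omega
  · exact (h.1 _).trans (Nat.le_succ _)
  · exact (h.2 _ _).trans (Nat.le_succ _)
  · exact Nat.add_le_add (h.1 _) (of_decide_eq_true he)
  · exact (Nat.sub_le _ _).trans ((h.2 _ _).trans (Nat.le_succ _))
  · simp at he

theorem Store.IndexBound.writeCell {s : Store} {B a i n : ℕ} (h : s.IndexBound B) (hn : n ≤ B) :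
    (s.writeCell a i n).IndexBound B := by
  refine ⟨h.1, fun a' k => ?_⟩
  simp only [Store.writeCell, Function.update_apply]
  split_ifs with h₁
  · subst h₁
    rw [Function.update_apply]
    split_ifs
    exacts [hn, h.2 _ _]
  · exact h.2 _ _

theorem Store.NumBound.writeNum {s : Store} {D M a i : ℕ} {x : ℝ} (h : s.NumBound D M)
    (hx : |x| ≤ M) (hz : ∃ z : ℤ, x * D = z) : (s.writeNum a i x).NumBound D M := by
  intro a' k
  simp only [Store.writeNum, Function.update_apply]
  split_ifs with h₁
  · subst h₁
    rw [Function.update_apply]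
    split_ifs
    exacts [⟨hx, hz⟩, h _ _]
  · exact h _ _

theorem Store.IndexBound.mono {s : Store} {B B' : ℕ} (h : s.IndexBound B) (hB : B ≤ B') :
    s.IndexBound B' :=
  ⟨fun x => (h.1 x).trans hB, fun a k => (h.2 a k).trans hB⟩

theorem Store.NumBound.mono {s : Store} {D M M' : ℕ} (h : s.NumBound D M) (hM : M ≤ M') :
    s.NumBound D M' :=
  fun a k => ⟨(h a k).1.trans (by exact_mod_cast hM), (h a k).2⟩

theorem isTame_step {c : List Program × Store} (hP : ∀ P ∈ c.1, P.isTame) :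
    ∀ P ∈ (step c).1, P.isTame := by
  obtain ⟨k, s⟩ := c
  match k with
  | [] => exact hP
  | .skip :: k | .setVar _ _ :: k | .setCell _ _ _ :: k | .setConst _ _ _ :: k
  | .copyNum _ _ _ _ :: k | .setNum _ _ _ _ _ _ _ :: k =>
    exact fun P h => hP P (List.mem_cons_of_mem _ h)
  | .seq c₁ c₂ :: k => simpa [step, Program.isTame, and_assoc] using hP
  | .cond b c₁ c₂ :: k =>
    simp only [List.mem_cons, forall_eq_or_imp, Program.isTame, Bool.and_eq_true] at hP
    simp only [step]
    split_ifs
    · simpa using ⟨hP.1.1, hP.2⟩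
    · simpa using ⟨hP.1.2, hP.2⟩
  | .loop b c :: k =>
    simp only [List.mem_cons, forall_eq_or_imp, Program.isTame] at hP
    simp only [step]
    split_ifs
    · simpa [Program.isTame] using hP
    · exact hP.2

theorem indexBound_step {c : List Program × Store} (hP : ∀ P ∈ c.1, P.isTame) {B : ℕ}
    (h : c.2.IndexBound B) : (step c).2.IndexBound (B + 1) := by
  obtain ⟨k, s⟩ := c
  have h' : s.IndexBound (B + 1) := h.mono (Nat.le_succ B)
  match k with
  | [] | .skip :: k | .setConst _ _ _ :: k | .copyNum _ _ _ _ :: k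
  | .setNum _ _ _ _ _ _ _ :: k | .seq c₁ c₂ :: k | .cond b c₁ c₂ :: k | .loop b c :: k => exact h'
  | .setVar x e :: k =>
    refine ⟨fun y => ?_, h'.2⟩
    simp only [step, Function.update_apply]
    split_ifs
    · exact IndexExpr.eval_le_of_isTame (hP _ List.mem_cons_self) h
    · exact h'.1 y
  | .setCell a e₁ e₂ :: k =>
    exact h'.writeCell (IndexExpr.eval_le_of_isTame (hP _ List.mem_cons_self) h)

/-- Sums and differences of fractions with denominator `D` have denominator `D` again, and their
absolute value at most doubles; the constants $0$ and $1$ are such fractions too. -/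
theorem numBound_step {c : List Program × Store} (hP : ∀ P ∈ c.1, P.isTame) {D M : ℕ}
    (hM : 1 ≤ M) (h : c.2.NumBound D M) : (step c).2.NumBound D (2 * M) := by
  obtain ⟨k, s⟩ := c
  have h' : s.NumBound D (2 * M) := h.mono (by omega)
  have hM' : (1 : ℝ) ≤ M := by exact_mod_cast hM
  match k with
  | [] | .skip :: k | .setVar _ _ :: k | .setCell _ _ _ :: k | .seq c₁ c₂ :: k
  | .cond b c₁ c₂ :: k | .loop b c :: k => exact h'
  | .copyNum a e b e₁ :: k => exact h'.writeNum (h' _ _).1 (h' _ _).2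
  | .setConst a e q :: k =>
    have hq := hP _ List.mem_cons_self
    simp only [Program.isTame, decide_eq_true_eq] at hq
    rcases hq with rfl | rfl
    · exact h'.writeNum (by simp) ⟨0, by simp⟩
    · refine h'.writeNum ?_ ⟨D, by simp⟩
      push_cast
      rw [abs_one]
      linarith
  | .setNum op a e b e₁ c e₂ :: k =>
    obtain ⟨hb, z₁, hz₁⟩ := h b (e₁.eval s)
    obtain ⟨hc, z₂, hz₂⟩ := h c (e₂.eval s)
    have hq := hP _ List.mem_cons_self
    simp only at hb hc hz₁ hz₂
    match op with
    | .add =>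
      refine h'.writeNum ((abs_add_le _ _).trans ?_) ⟨z₁ + z₂, ?_⟩
      · push_cast
        linarith
      · push_cast
        rw [← hz₁, ← hz₂]
        exact add_mul _ _ _
    | .sub =>
      refine h'.writeNum ((abs_sub _ _).trans ?_) ⟨z₁ - z₂, ?_⟩
      · push_cast
        linarith
      · push_cast
        rw [← hz₁, ← hz₂]
        exact sub_mul _ _ _
    | .mul => simp [Program.isTame] at hq
    | .div => simp [Program.isTame] at hq

theorem isTame_run {P : Program} (hP : P.isTame) (s : Store) (t : ℕ) :
    ∀ P' ∈ (run P s t).1, P'.isTame := by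
  induction t with
  | zero => simpa [run] using hP
  | succ t ih =>
    rw [run, Function.iterate_succ_apply']
    exact isTame_step ih

theorem indexBound_run {P : Program} (hP : P.isTame) {s : Store} {B : ℕ} (h : s.IndexBound B)
    (t : ℕ) : (run P s t).2.IndexBound (B + t) := by
  induction t with
  | zero => exact h
  | succ t ih =>
    rw [run, Function.iterate_succ_apply']
    exact indexBound_step (isTame_run hP s t) ih

theorem numBound_run {P : Program} (hP : P.isTame) {s : Store} {D M : ℕ} (hM : 1 ≤ M)
    (h : s.NumBound D M) (t : ℕ) : (run P s t).2.NumBound D (2 ^ t * M) := by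
  induction t with
  | zero => simpa [run] using h
  | succ t ih =>
    rw [run, Function.iterate_succ_apply', pow_succ', mul_assoc]
    exact numBound_step (isTame_run hP s t) (Nat.mul_pos (by positivity) hM) ih

theorem run_of_halted {P : Program} {s : Store} {t₀ : ℕ} (h : (run P s t₀).1 = []) {t : ℕ}
    (ht : t₀ ≤ t) : run P s t = run P s t₀ := by
  induction t, ht using Nat.le_induction with
  | base => rfl
  | succ t _ ih =>
    rw [run, Function.iterate_succ_apply', ← run, ih]
    generalize run P s t₀ = c at h
    obtain ⟨k, s'⟩ := c
    subst h
    rfl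

/-- A halting computation passes through no other stores than those up to the halting time. -/
theorem exists_le_run_eq {P : Program} {s : Store} {t₀ : ℕ} (h : (run P s t₀).1 = []) (t : ℕ) :
    ∃ t' ≤ t₀, run P s t = run P s t' := by
  rcases le_total t t₀ with ht | ht
  · exact ⟨t, ht, rfl⟩
  · exact ⟨t₀, le_rfl, run_of_halted h ht⟩

/-! ### The encoding length of the numbers -/

/-- The reduced denominator divides `D`, and the numerator is the value times that denominator,
hence at most `M * D`. -/
theorem bitSize_le {q : ℚ} {D M a : ℕ} (hD : 0 < D) (hDa : D ≤ 2 ^ a) {b : ℕ} (hM : M ≤ 2 ^ b)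
    (hq : |q| ≤ M) {z : ℤ} (hz : q * D = z) : bitSize q ≤ 2 * a + b + 2 := by
  have hD' : (0 : ℚ) < D := by exact_mod_cast hD
  have hden : q.den ∣ D := by
    have : q = Rat.divInt z D := by
      rw [Rat.divInt_eq_div, ← hz]
      field_simp
      push_cast
      ring
    have h := Rat.den_dvd z D
    rw [← this] at h
    exact_mod_cast h
  have hden' : q.den ≤ 2 ^ a := (Nat.le_of_dvd hD hden).trans hDa
  have hnum : q.num.natAbs ≤ M * D := by
    have h1 : |(q.num : ℚ)| = |q| * q.den := by
      rw [← Rat.mul_den_eq_num, abs_mul, Nat.abs_cast]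
    have h2 : |(q.num : ℚ)| ≤ M * D := by
      rw [h1]
      have : (q.den : ℚ) ≤ D := by exact_mod_cast Nat.le_of_dvd hD hden
      gcongr
    have h3 : ((q.num.natAbs : ℕ) : ℚ) ≤ (M * D : ℕ) := by
      rw [Nat.cast_natAbs]
      push_cast
      exact h2
    exact_mod_cast h3
  have h1 : Nat.size q.den ≤ a + 1 := by
    rw [Nat.size_le]
    exact hden'.trans_lt (Nat.pow_lt_pow_right (by norm_num) (Nat.lt_succ_self a))
  have h2 : Nat.size q.num.natAbs ≤ a + b + 1 := by
    rw [Nat.size_le]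
    calc q.num.natAbs ≤ 2 ^ b * 2 ^ a := hnum.trans (Nat.mul_le_mul hM hDa)
      _ = 2 ^ (a + b) := by rw [← pow_add, add_comm]
      _ < _ := Nat.pow_lt_pow_right (by norm_num) (Nat.lt_succ_self _)
  unfold bitSize
  omega

theorem indexBound_input {d m : ℕ} (A : Matrix (Fin d) (Fin m) (WithBot ℝ)) :
    (input A).IndexBound (d + m + 1) := by
  refine ⟨fun x => ?_, fun a k => ?_⟩ <;> simp only [input] <;> split_ifs <;> omega

/-- The denominator of a finite entry; `1` for `-∞`. -/
def tropDen : WithBot ℚ → ℕ := WithBot.recBotCoe 1 Rat.den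

theorem numBound_input {d m : ℕ} (B : Matrix (Fin d) (Fin m) (WithBot ℚ)) :
    ∃ D : ℕ, 0 < D ∧ D ≤ 2 ^ inputSize B ∧
      (input (B.map (WithBot.map (fun x : ℚ => (x : ℝ))))).NumBound D (2 ^ inputSize B) := by
  have hpos : ∀ x : WithBot ℚ, 0 < tropDen x := by
    intro x
    induction x using WithBot.recBotCoe with
    | bot => exact Nat.one_pos
    | coe q => exact q.den_pos
  have hle : ∀ x : WithBot ℚ, tropDen x ≤ 2 ^ tropBitSize x := by
    intro x
    induction x using WithBot.recBotCoe with
    | bot => exact Nat.one_le_two_pow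
    | coe q =>
      exact (Nat.lt_size_self q.den).le.trans
        (Nat.pow_le_pow_right (by norm_num) (Nat.le_add_left _ _))
  have hsize : ∀ i j, tropBitSize (B i j) ≤ inputSize B := fun i j =>
    (Finset.single_le_sum (f := fun j => tropBitSize (B i j)) (fun _ _ => Nat.zero_le _)
      (Finset.mem_univ j)).trans ((Finset.single_le_sum (f := fun i => ∑ j, tropBitSize (B i j))
      (fun _ _ => Nat.zero_le _) (Finset.mem_univ i)).trans (Nat.le_add_left _ _))
  -- The product of all denominators is a common denominator whose length is at most the sum of the
  -- lengths, so no least common multiple is needed.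
  refine ⟨∏ i, ∏ j, tropDen (B i j),
    Finset.prod_pos fun i _ => Finset.prod_pos fun j _ => hpos _, ?_, fun a k => ?_⟩
  · calc ∏ i, ∏ j, tropDen (B i j) ≤ ∏ i, ∏ j, 2 ^ tropBitSize (B i j) :=
          Finset.prod_le_prod' fun i _ => Finset.prod_le_prod' fun j _ => hle _
      _ = 2 ^ ∑ i, ∑ j, tropBitSize (B i j) := by simp_rw [Finset.prod_pow_eq_pow_sum]
      _ ≤ _ := Nat.pow_le_pow_right (by norm_num) (Nat.le_add_left _ _)
  · have hzero : |(0 : ℝ)| ≤ (2 ^ inputSize B : ℕ) ∧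
        ∃ z : ℤ, (0 : ℝ) * (∏ i, ∏ j, tropDen (B i j) : ℕ) = z := ⟨by simp, 0, by simp⟩
    simp only [input]
    split_ifs with ha
    swap
    · exact hzero
    unfold entry
    split_ifs with hk
    swap
    · exact hzero
    generalize (finProdFinEquiv.symm ⟨k, hk⟩).1 = i
    generalize (finProdFinEquiv.symm ⟨k, hk⟩).2 = j
    have hsz := hsize i j
    have hdvd : tropDen (B i j) ∣ ∏ i, ∏ j, tropDen (B i j) :=
      (Finset.dvd_prod_of_mem (fun j => tropDen (B i j)) (Finset.mem_univ j)).trans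
        (Finset.dvd_prod_of_mem (fun i => ∏ j, tropDen (B i j)) (Finset.mem_univ i))
    rw [Matrix.map_apply]
    generalize B i j = x at hsz hdvd
    induction x using WithBot.recBotCoe with
    | bot => exact hzero
    | coe q =>
      obtain ⟨e, he⟩ := hdvd
      have hden : (q.den : ℝ) ≠ 0 := by exact_mod_cast q.den_nz
      have hq : (q : ℝ) = q.num / q.den := by exact_mod_cast (Rat.num_div_den q).symm
      refine ⟨?_, q.num * e, ?_⟩
      · simp only [WithBot.map_coe, WithBot.unbotD_coe]
        have h1 : |(q : ℝ)| ≤ (q.num.natAbs : ℕ) := by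
          rw [hq, abs_div, Nat.abs_cast, Nat.cast_natAbs, Int.cast_abs]
          exact div_le_self (abs_nonneg _) (by exact_mod_cast q.den_pos)
        refine h1.trans ?_
        have : q.num.natAbs ≤ 2 ^ inputSize B :=
          (Nat.lt_size_self _).le.trans (Nat.pow_le_pow_right (by norm_num)
            ((Nat.le_add_right _ _).trans hsz))
        exact_mod_cast this
      · simp only [WithBot.map_coe, WithBot.unbotD_coe]
        rw [he, hq]
        simp only [tropDen, WithBot.recBotCoe_coe]
        push_cast
        field_simp

theorem eval_mono (p : Polynomial ℕ) {a b : ℕ} (h : a ≤ b) : p.eval a ≤ p.eval b := by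
  rw [Polynomial.eval_eq_sum, Polynomial.eval_eq_sum]
  exact Finset.sum_le_sum fun i _ => Nat.mul_le_mul_left _ (Nat.pow_le_pow_left h i)

/-- A tame program which halts with the right output within its time bound runs in strongly
polynomial time. -/
theorem computesInStronglyPolynomialTime_of_isTame {P : Program} (hP : P.isTame)
    {f : ∀ d m : ℕ, Matrix (Fin d) (Fin m) (WithBot ℝ) → EReal}
    (h : ∀ (d m : ℕ) (A : Matrix (Fin d) (Fin m) (WithBot ℝ)),
      WP (d + m) P (input A) fun s => toEReal (output s) = f d m A) :
    P.ComputesInStronglyPolynomialTime f := by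
  have hrun : ∀ (d m : ℕ) (A : Matrix (Fin d) (Fin m) (WithBot ℝ)),
      ∃ t ≤ P.timeBound.eval (d + m), (run P (input A) t).1 = [] ∧
        toEReal (output (run P (input A) t).2) = f d m A := by
    intro d m A
    obtain ⟨s, t, ht, he, -, hs⟩ := h d m A
    refine ⟨t, ht, ?_, ?_⟩
    · rw [run, he]
    · rw [run, he]
      exact hs
  have heval : ∀ n, (P.timeBound + 3 * Polynomial.X + 2).eval n =
      P.timeBound.eval n + 3 * n + 2 := fun n => by simp
  -- The term `3 * X + 2` comes from `bitSize_le`: the denominator has exponent `inputSize B`,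
  -- counted twice, and the magnitude has exponent `t' + inputSize B`. It also covers the initial
  -- index bound `d + m + 1`.
  refine ⟨P.timeBound + 3 * Polynomial.X + 2, fun d m A => ?_, fun d m A t => ?_,
    fun d m B t a k => ?_⟩
  · obtain ⟨t, ht, hh⟩ := hrun d m A
    exact ⟨t, by rw [heval]; omega, hh⟩
  · obtain ⟨t₀, ht₀, hh, -⟩ := hrun d m A
    obtain ⟨t', ht', he⟩ := exists_le_run_eq hh t
    rw [he]
    exact (indexBound_run hP (indexBound_input A) t').mono (by rw [heval]; omega)
  · obtain ⟨t₀, ht₀, hh, -⟩ := hrun d m (B.map (WithBot.map (fun x : ℚ => (x : ℝ))))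
    obtain ⟨t', ht', he⟩ := exists_le_run_eq hh t
    obtain ⟨D, hD, hDle, hin⟩ := numBound_input B
    obtain ⟨hb, z, hz⟩ := numBound_run hP Nat.one_le_two_pow hin t' a k
    rw [he]
    have hD' : (D : ℝ) ≠ 0 := by exact_mod_cast hD.ne'
    have hx := eq_div_of_mul_eq hD' hz
    have hq : (((z : ℚ) / D : ℚ) : ℝ) = (z : ℝ) / D := by push_cast; rfl
    refine ⟨(z : ℚ) / D, by rw [hx, hq], ?_⟩
    have hsize : d + m ≤ inputSize B := Nat.le_add_right _ _
    have hT : t' ≤ P.timeBound.eval (inputSize B) :=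
      ht'.trans (ht₀.trans (eval_mono _ hsize))
    have hbound := bitSize_le (q := (z : ℚ) / D) (D := D) (M := 2 ^ t' * 2 ^ inputSize B) hD hDle
      (b := t' + inputSize B) (by rw [pow_add]) (by
        rw [hx, ← hq] at hb
        exact_mod_cast hb) (z := z) (by
        have : (D : ℚ) ≠ 0 := by exact_mod_cast hD.ne'
        field_simp)
    rw [heval]
    omega

/-! ### The volume of the convex hull of the columns of a matrix -/

section Volume

variable {d m : ℕ}

/-- The columns of the matrix `a` which are selected by `f`, with an additional first row of
ones. -/
def homogenization (a : Fin d → Fin m → ℝ) (f : Fin (d + 1) → Fin m) :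
    Matrix (Fin (d + 1)) (Fin (d + 1)) ℝ :=
  Matrix.of fun k j => (Fin.cons 1 (fun i => a i (f j)) : Fin (d + 1) → ℝ) k

theorem det_homogenization (a : Fin d → Fin m → ℝ) (f : Fin (d + 1) → Fin m) :
    (homogenization a f).det =
      ∑ σ : Equiv.Perm (Fin (d + 1)), (Equiv.Perm.sign σ : ℝ) * ∏ i, a i (f (σ i.succ)) := by
  rw [← Matrix.det_transpose, Matrix.det_apply']
  refine Finset.sum_congr rfl fun σ _ => ?_
  rw [Fin.prod_univ_succ]
  simp [homogenization]

/-- Subtracting column $0$ from the others turns the row of ones into $(1,0,\dots,0)$; then expand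
along that row. The auxiliary `B` is transposed because the elimination lemma acts on rows. -/
theorem det_homogenization_eq_det_sub (a : Fin d → Fin m → ℝ) (f : Fin (d + 1) → Fin m) :
    (homogenization a f).det =
      (Matrix.of fun i j : Fin d => a i (f j.succ) - a i (f 0)).det := by
  set B : Matrix (Fin (d + 1)) (Fin (d + 1)) ℝ := Matrix.of fun j k =>
    homogenization a f k j - (if j = 0 then 0 else homogenization a f k 0) with hB
  have h : (homogenization a f).det = B.det := by
    rw [← Matrix.det_transpose]
    refine Matrix.det_eq_of_forall_row_eq_smul_add_const (fun j => if j = 0 then 0 else 1) 0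
      (by simp) fun i j => ?_
    by_cases hi : i = 0 <;> simp [hB, hi]
  rw [h, ← Matrix.det_transpose, Matrix.det_succ_row_zero, Fin.sum_univ_succ]
  have h0 : ∀ i : Fin d, B.transpose 0 i.succ = 0 := fun i => by simp [hB, homogenization]
  simp only [h0]
  have h1 : B.transpose 0 0 = 1 := by simp [hB, homogenization]
  simp only [h1, mul_zero, zero_mul, Finset.sum_const_zero, add_zero, Fin.val_zero, pow_zero,
    one_mul]
  congr 1

theorem det_homogenization_of_not_injective (a : Fin d → Fin m → ℝ) {f : Fin (d + 1) → Fin m}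
    (hf : ¬ Function.Injective f) : (homogenization a f).det = 0 := by
  simp only [Function.Injective, not_forall] at hf
  obtain ⟨i, j, hij, hne⟩ := hf
  exact Matrix.det_zero_of_column_eq hne fun k => by simp [homogenization, hij]

/-- The affine map which takes the standard simplex to the simplex spanned by selected columns
multiplies volumes by the absolute value of a determinant. -/
theorem volume_image_affine (a : Fin d → Fin m → ℝ) (f : Fin (d + 1) → Fin m)
    (s : Set (Fin d → ℝ)) :
    volume.real ((fun x => (fun i => a i (f 0)) +
      Matrix.toLin' (Matrix.of fun i j : Fin d => a i (f j.succ) - a i (f 0)) x) '' s) =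
      |(homogenization a f).det| * volume.real s := by
  have h := Measure.addHaar_image_linearMap (volume : Measure (Fin d → ℝ))
    (Matrix.toLin' (Matrix.of fun i j : Fin d => a i (f j.succ) - a i (f 0))) s
  rw [show (fun x => (fun i => a i (f 0)) +
      Matrix.toLin' (Matrix.of fun i j : Fin d => a i (f j.succ) - a i (f 0)) x) =
      (fun y => (fun i => a i (f 0)) + y) ∘
      Matrix.toLin' (Matrix.of fun i j : Fin d => a i (f j.succ) - a i (f 0)) from rfl,
    Set.image_comp, measureReal_def, Set.image_add_left, measure_preimage_add, h,
    LinearMap.det_toLin', ← det_homogenization_eq_det_sub, ENNReal.toReal_mul,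
    ENNReal.toReal_ofReal (abs_nonneg _), measureReal_def]

theorem affine_apply (a : Fin d → Fin m → ℝ) (f : Fin (d + 1) → Fin m) (x : Fin d → ℝ) :
    ((fun i => a i (f 0)) +
      Matrix.toLin' (Matrix.of fun i j : Fin d => a i (f j.succ) - a i (f 0)) x) =
      ∑ k, (Fin.cons (1 - ∑ j, x j) x : Fin (d + 1) → ℝ) k • fun i => a i (f k) := by
  ext i
  simp only [Pi.add_apply, Matrix.toLin'_apply, Matrix.mulVec, dotProduct, Matrix.of_apply,
    Fin.sum_univ_succ, Fin.cons_zero, Fin.cons_succ, Pi.smul_apply, Finset.sum_apply, smul_eq_mul]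
  simp only [sub_mul, Finset.sum_sub_distrib, one_mul, Finset.sum_mul]
  simp only [mul_comm]
  ring

/-- The simplex lies in the parallelepiped that is the affine image of the unit cube. The lost
factor $1/d!$ does not matter for valuations. -/
theorem volume_convexHull_simplex_le (a : Fin d → Fin m → ℝ) (f : Fin (d + 1) → Fin m) :
    volume.real (convexHull ℝ (Set.range fun k => (fun i => a i (f k)))) ≤
      |(homogenization a f).det| := by
  set g : (Fin d → ℝ) → (Fin d → ℝ) := fun x => (fun i => a i (f 0)) +
      Matrix.toLin' (Matrix.of fun i j : Fin d => a i (f j.succ) - a i (f 0)) x with hg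
  have hvol : volume.real (g '' Set.Icc 0 1) = |(homogenization a f).det| := by
    rw [volume_image_affine, measureReal_def, Real.volume_Icc_pi_toReal zero_le_one]
    simp
  have hcont : Continuous g := by
    rw [hg]
    exact continuous_const.add (LinearMap.continuous_of_finiteDimensional _)
  have hconv : Convex ℝ (g '' Set.Icc 0 1) := by
    rw [hg, show (fun x => (fun i => a i (f 0)) +
      Matrix.toLin' (Matrix.of fun i j : Fin d => a i (f j.succ) - a i (f 0)) x) =
      (fun y => (fun i => a i (f 0)) + y) ∘
      Matrix.toLin' (Matrix.of fun i j : Fin d => a i (f j.succ) - a i (f 0)) from rfl,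
      Set.image_comp]
    exact ((convex_Icc _ _).linear_image _).translate _
  rw [← hvol]
  refine measureReal_mono (convexHull_min ?_ hconv)
    ((isCompact_Icc.image hcont).measure_lt_top.ne)
  rintro _ ⟨k, rfl⟩
  cases k using Fin.cases with
  | zero =>
    refine ⟨0, ⟨le_rfl, zero_le_one⟩, ?_⟩
    simp [hg]
  | succ k =>
    refine ⟨Pi.single k 1, ⟨fun j => ?_, fun j => ?_⟩, ?_⟩
    · by_cases h : j = k
      · subst h; simp
      · simp [h]
    · by_cases h : j = k
      · subst h; simp
      · simp [h]
    · ext i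
      simp [hg]

/-- The cube with side $1/(d+1)$ lies in the standard simplex, so its affine image lies in the hull.
This avoids computing the volume of a simplex. -/
theorem le_volume_convexHull (a : Fin d → Fin m → ℝ) (f : Fin (d + 1) → Fin m) :
    |(homogenization a f).det| * (1 / (d + 1 : ℝ)) ^ d ≤
      volume.real (convexHull ℝ (Set.range fun j => (fun i => a i j))) := by
  have hpos : (0 : ℝ) < d + 1 := by positivity
  have hvol : volume.real (Set.Icc (0 : Fin d → ℝ) (fun _ => 1 / (d + 1 : ℝ))) =
      (1 / (d + 1 : ℝ)) ^ d := by
    rw [measureReal_def, Real.volume_Icc_pi_toReal (fun _ => by positivity)]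
    simp
  rw [← hvol, ← volume_image_affine]
  refine measureReal_mono ?_ ((Set.finite_range _).isCompact_convexHull ℝ).measure_lt_top.ne
  rintro _ ⟨x, ⟨hx0, hx1⟩, rfl⟩
  dsimp only
  rw [affine_apply]
  have hsum : ∑ j, x j ≤ 1 := by
    calc ∑ j, x j ≤ ∑ _j : Fin d, 1 / (d + 1 : ℝ) := Finset.sum_le_sum fun j _ => hx1 j
      _ ≤ 1 := by
        simp only [Finset.sum_const, Finset.card_univ, Fintype.card_fin, nsmul_eq_mul]
        rw [mul_one_div, div_le_one hpos]
        linarith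
  refine (convex_convexHull ℝ _).sum_mem (fun k _ => ?_) ?_ fun k _ =>
    subset_convexHull ℝ _ ⟨f k, rfl⟩
  · cases k using Fin.cases with
    | zero => simpa using hsum
    | succ k => simpa using hx0 k
  · simp [Fin.sum_univ_succ]

theorem volume_convexHull_le (a : Fin d → Fin m → ℝ) :
    volume.real (convexHull ℝ (Set.range fun j => (fun i => a i j))) ≤
      ∑ f : Fin (d + 1) → Fin m, |(homogenization a f).det| := by
  have hsub : convexHull ℝ (Set.range fun j => (fun i => a i j)) ⊆
      ⋃ f : Fin (d + 1) → Fin m, convexHull ℝ (Set.range fun k => (fun i => a i (f k))) := by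
    intro x hx
    rw [convexHull_eq_union] at hx
    simp only [Set.mem_iUnion] at hx
    obtain ⟨t, hts, hti, hxt⟩ := hx
    have hcard : Fintype.card t ≤ Fintype.card (Fin (d + 1)) := by
      refine hti.card_le_finrank_succ.trans ?_
      rw [Fintype.card_fin]
      exact Nat.add_le_add_right ((Submodule.finrank_le _).trans (by simp)) 1
    obtain ⟨e⟩ := Function.Embedding.nonempty_of_card_le hcard
    have hne : Nonempty t := by
      rcases t.eq_empty_or_nonempty with h | h
      · simp [h] at hxt
      · exact h.to_subtype
    -- Carathéodory's affinely independent set has at most $d+1$ points; a left inverse of `e` turns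
    -- it into a family indexed by `Fin (d + 1)`, possibly with repetitions.
    choose g hg using fun y : t => hts y.2
    refine Set.mem_iUnion.2 ⟨fun k => g (Function.invFun e k), ?_⟩
    refine convexHull_mono ?_ hxt
    intro y hy
    obtain ⟨k, hk⟩ := Function.invFun_surjective e.injective ⟨y, hy⟩
    refine ⟨k, ?_⟩
    have := hg (Function.invFun e k)
    rw [hk] at this
    simpa [hk] using this
  have hfin : volume (⋃ f : Fin (d + 1) → Fin m,
      convexHull ℝ (Set.range fun k => (fun i => a i (f k)))) ≠ ⊤ :=
    (isCompact_iUnion fun f => (Set.finite_range _).isCompact_convexHull ℝ).measure_lt_top.ne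
  exact (measureReal_mono hsub hfin).trans ((measureReal_iUnion_fintype_le _).trans
    (Finset.sum_le_sum fun f _ => volume_convexHull_simplex_le a f))

/-- If all transversals with columns in general position have products at most `M`, then the volume
is at most a multiple of `M`. -/
theorem volume_convexHull_le_of_prod_le (a : Fin d → Fin m → ℝ) {M : ℝ} (hM : 0 ≤ M)
    (h : d < m → ∀ f : Fin d ↪ Fin m, ∏ i, |a i (f i)| ≤ M) :
    volume.real (convexHull ℝ (Set.range fun j => (fun i => a i j))) ≤
      (m ^ (d + 1) * (d + 1).factorial : ℕ) * M := by
  refine (volume_convexHull_le a).trans ?_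
  have hf : ∀ f : Fin (d + 1) → Fin m, |(homogenization a f).det| ≤ (d + 1).factorial * M := by
    intro f
    -- Only families without repetition contribute, and they exist only if `d < m`, which is why the
    -- bound on products is assumed only in that case.
    by_cases hf : Function.Injective f
    · have hdm : d < m := by simpa using Fintype.card_le_of_injective f hf
      rw [det_homogenization]
      refine (Finset.abs_sum_le_sum_abs _ _).trans ?_
      calc ∑ σ : Equiv.Perm (Fin (d + 1)), |(Equiv.Perm.sign σ : ℝ) * ∏ i, a i (f (σ i.succ))|
          ≤ ∑ _σ : Equiv.Perm (Fin (d + 1)), M := by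
            refine Finset.sum_le_sum fun σ _ => ?_
            rw [abs_mul, Finset.abs_prod, ← Int.cast_abs, Equiv.Perm.sign_abs]
            simpa using h hdm ⟨fun i => f (σ i.succ),
              hf.comp (σ.injective.comp (Fin.succ_injective d))⟩
        _ = _ := by simp [Fintype.card_perm]
    · rw [det_homogenization_of_not_injective a hf, abs_zero]
      positivity
  refine (Finset.sum_le_sum fun f _ => hf f).trans ?_
  simp [mul_assoc]

end Volume

/-! ### Valuations -/

theorem hasVal_const_mul_rpow {C : ℝ} (hC : 0 < C) (r : ℝ) :
    HasVal (fun t => C * t ^ r) (r : EReal) := by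
  have h : Tendsto (fun t : ℝ => ((Real.log C / Real.log t + r : ℝ) : EReal)) atTop
      (𝓝 (r : EReal)) := by
    refine (continuous_coe_real_ereal.tendsto r).comp ?_
    have := (Tendsto.const_div_atTop Real.tendsto_log_atTop (Real.log C)).add_const r
    rwa [zero_add] at this
  refine h.congr' ?_
  filter_upwards [eventually_gt_atTop 1] with t ht
  have ht0 : 0 < t := by linarith
  have hlog : 0 < Real.log t := Real.log_pos ht
  have hpos : 0 < C * t ^ r := mul_pos hC (Real.rpow_pos_of_pos ht0 r)
  rw [abs_of_pos hpos, ENNReal.log_ofReal_of_pos hpos, ← EReal.coe_div,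
    Real.log_mul hC.ne' (Real.rpow_pos_of_pos ht0 r).ne', Real.log_rpow ht0]
  congr 1
  field_simp

theorem hasVal_zero : HasVal (fun _ => 0) ⊥ := by
  refine tendsto_const_nhds.congr' ?_
  filter_upwards [eventually_gt_atTop 1] with t ht
  have hlog : (0 : EReal) < (Real.log t : EReal) := by exact_mod_cast Real.log_pos ht
  simp [EReal.bot_div_of_pos_ne_top hlog (EReal.coe_ne_top _)]

theorem log_div_log_mono {x y t : ℝ} (h : |x| ≤ |y|) (ht : 1 < t) :
    ENNReal.log (ENNReal.ofReal |x|) / (Real.log t : EReal) ≤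
      ENNReal.log (ENNReal.ofReal |y|) / (Real.log t : EReal) := by
  have hlog : (0 : EReal) ≤ (Real.log t : EReal) := by exact_mod_cast (Real.log_pos ht).le
  exact EReal.div_le_div_right_of_nonneg hlog (ENNReal.log_monotone (ENNReal.ofReal_le_ofReal h))

theorem HasVal.le {f g : ℝ → ℝ} {x y : EReal} (hf : HasVal f x) (hg : HasVal g y)
    (h : ∀ᶠ t in atTop, |f t| ≤ |g t|) : x ≤ y := by
  refine le_of_tendsto_of_tendsto hf hg ?_
  filter_upwards [h, eventually_gt_atTop 1] with t ht ht1
  exact log_div_log_mono ht ht1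

theorem HasVal.squeeze {f g h : ℝ → ℝ} {x : EReal} (hf : HasVal f x) (hh : HasVal h x)
    (hfg : ∀ᶠ t in atTop, |f t| ≤ |g t|) (hgh : ∀ᶠ t in atTop, |g t| ≤ |h t|) : HasVal g x := by
  refine tendsto_of_tendsto_of_tendsto_of_le_of_le' hf hh ?_ ?_
  · filter_upwards [hfg, eventually_gt_atTop 1] with t ht ht1
    exact log_div_log_mono ht ht1
  · filter_upwards [hgh, eventually_gt_atTop 1] with t ht ht1
    exact log_div_log_mono ht ht1

theorem HasVal.eventually_le_rpow {f : ℝ → ℝ} {x : EReal} (hf : HasVal f x) {r : ℝ}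
    (hr : x < (r : EReal)) : ∀ᶠ t in atTop, |f t| ≤ t ^ r := by
  filter_upwards [hf.eventually_lt_const hr, eventually_gt_atTop 1] with t ht ht1
  have ht0 : 0 < t := by linarith
  have hlog : (0 : EReal) < (Real.log t : EReal) := by exact_mod_cast Real.log_pos ht1
  rw [EReal.div_lt_iff hlog (EReal.coe_ne_top _), ← EReal.coe_mul, ← Real.log_rpow ht0,
    ← ENNReal.log_ofReal_of_pos (Real.rpow_pos_of_pos ht0 r), ENNReal.log_lt_log_iff] at ht
  exact (ENNReal.ofReal_lt_ofReal_iff (Real.rpow_pos_of_pos ht0 r)).1 ht |>.le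

theorem toEReal_lt_coe {x : WithBot ℝ} {r : ℝ} : toEReal x < (r : EReal) ↔ x < (r : WithBot ℝ) := by
  induction x using WithBot.recBotCoe with
  | bot => simp [toEReal, EReal.bot_lt_coe]
  | coe x => simp [toEReal]

/-! ### The upper dequantized volume as the value of an assignment problem -/

theorem exists_add_eq_of_add_lt {x y : WithBot ℝ} {r : ℝ} (h : x + y < (r : WithBot ℝ)) :
    ∃ p q : ℝ, x < (p : WithBot ℝ) ∧ y < (q : WithBot ℝ) ∧ p + q = r := by
  induction x using WithBot.recBotCoe with
  | bot =>
    induction y using WithBot.recBotCoe with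
    | bot => exact ⟨0, r, WithBot.bot_lt_coe _, WithBot.bot_lt_coe _, by ring⟩
    | coe y =>
      exact ⟨r - y - 1, y + 1, WithBot.bot_lt_coe _, WithBot.coe_lt_coe.2 (by linarith), by ring⟩
  | coe x =>
    induction y using WithBot.recBotCoe with
    | bot =>
      exact ⟨x + 1, r - x - 1, WithBot.coe_lt_coe.2 (by linarith), WithBot.bot_lt_coe _, by ring⟩
    | coe y =>
      have h' : x + y < r := by exact_mod_cast h
      exact ⟨x + (r - x - y) / 2, y + (r - x - y) / 2, WithBot.coe_lt_coe.2 (by linarith),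
        WithBot.coe_lt_coe.2 (by linarith), by ring⟩

/-- This distributes the gap below `r` over the summands. It turns a bound on a tropical sum into
bounds by real powers for the single factors, even if some of them have valuation $-\infty$. -/
theorem exists_sum_le_of_sum_lt {ι : Type*} (s : Finset ι) (x : ι → WithBot ℝ) {r : ℝ}
    (h : ∑ i ∈ s, x i < (r : WithBot ℝ)) :
    ∃ b : ι → ℝ, (∀ i ∈ s, x i < (b i : WithBot ℝ)) ∧ ∑ i ∈ s, b i ≤ r := by
  classical
  induction s using Finset.induction_on generalizing r with
  | empty => exact ⟨0, by simp, by simpa using WithBot.coe_lt_coe.1 h |>.le⟩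
  | insert a s ha ih =>
    rw [Finset.sum_insert ha] at h
    obtain ⟨p, q, hp, hq, hpq⟩ := exists_add_eq_of_add_lt h
    obtain ⟨b, hb, hbs⟩ := ih hq
    have hne : ∀ i ∈ s, i ≠ a := fun i hi h => ha (h ▸ hi)
    refine ⟨Function.update b a p, fun i hi => ?_, ?_⟩
    · rcases Finset.mem_insert.1 hi with rfl | hi
      · simpa using hp
      · simpa [hne i hi] using hb i hi
    · rw [Finset.sum_insert ha, Function.update_self,
        Finset.sum_congr rfl fun i hi => Function.update_of_ne (hne i hi) p b]
      linarith

section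

variable {K : Subring (Germ (atTop : Filter ℝ) ℝ)} {d m : ℕ}
  {A : Matrix (Fin d) (Fin m) (WithBot ℝ)}

theorem IsLift.eventually_prod_le {a : Fin d → Fin m → ℝ → ℝ} (ha : IsLift K A a)
    (f : Fin d → Fin m) {r : ℝ} (hr : ∑ i, A i (f i) < (r : WithBot ℝ)) :
    ∀ᶠ t in atTop, ∏ i, |a i (f i) t| ≤ t ^ r := by
  obtain ⟨b, hb, hbr⟩ := exists_sum_le_of_sum_lt Finset.univ (fun i => A i (f i)) hr
  have h : ∀ᶠ t in atTop, ∀ i, |a i (f i) t| ≤ t ^ b i :=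
    eventually_all.2 fun i =>
      (ha.val i (f i)).eventually_le_rpow (toEReal_lt_coe.2 (hb i (Finset.mem_univ i)))
  filter_upwards [h, eventually_gt_atTop 1] with t ht ht1
  calc ∏ i, |a i (f i) t| ≤ ∏ i, t ^ b i :=
        Finset.prod_le_prod (fun _ _ => abs_nonneg _) fun i _ => ht i
    _ = t ^ ∑ i, b i := (Real.rpow_sum_of_pos (by linarith) _ _).symm
    _ ≤ t ^ r := Real.rpow_le_rpow_of_exponent_le ht1.le hbr

theorem IsLift.val_volConv_le {a : Fin d → Fin m → ℝ → ℝ} (ha : IsLift K A a) {w : EReal}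
    (hw : HasVal (volConv a) w) {v : WithBot ℝ}
    (hv : d < m → ∀ f : Fin d ↪ Fin m, ∑ i, A i (f i) ≤ v) : w ≤ toEReal v := by
  refine le_of_forall_gt_imp_ge_of_dense fun u hu => ?_
  obtain ⟨r, hvr, hru⟩ := EReal.lt_iff_exists_real_btwn.1 hu
  refine le_trans ?_ hru.le
  -- The summand $1$ keeps the constant positive when `m = 0`.
  set C : ℝ := (m ^ (d + 1) * (d + 1).factorial : ℕ) + 1 with hC
  have hC0 : 0 < C := by positivity
  refine hw.le (hasVal_const_mul_rpow hC0 r) ?_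
  have h : ∀ᶠ t in atTop, d < m → ∀ f : Fin d ↪ Fin m, ∏ i, |a i (f i) t| ≤ t ^ r := by
    by_cases hdm : d < m
    · filter_upwards [eventually_all.2 fun f : Fin d ↪ Fin m => ha.eventually_prod_le f
        ((hv hdm f).trans_lt (toEReal_lt_coe.1 hvr))] with t ht _ using ht
    · exact Eventually.of_forall fun t h => absurd h hdm
  filter_upwards [h, eventually_gt_atTop 1] with t ht ht1
  have htr : 0 ≤ t ^ r := Real.rpow_nonneg (by linarith) r
  rw [abs_of_nonneg (mul_nonneg hC0.le htr), volConv, abs_of_nonneg measureReal_nonneg]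
  refine (volume_convexHull_le_of_prod_le (fun i j => a i j t) htr ht).trans ?_
  rw [hC]
  gcongr
  linarith

theorem qvolPlus_eq_bot (h : d < m → ∀ f : Fin d ↪ Fin m, ∑ i, A i (f i) = ⊥) :
    qvolPlus K A = ⊥ := by
  refine le_bot_iff.1 (sSup_le ?_)
  rintro w ⟨a, ha, hw⟩
  exact ha.val_volConv_le hw (v := ⊥) fun hdm f => (h hdm f).le

/-! ### Monomial lifts and the lower bound -/

/-- The monomial lift of `A` with leading coefficients `c`. -/
noncomputable def monomialLift (A : Matrix (Fin d) (Fin m) (WithBot ℝ)) (c : Fin d → Fin m → ℕ)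
    (i : Fin d) (j : Fin m) (t : ℝ) : ℝ :=
  c i j * (A i j).recBotCoe 0 (fun r => t ^ r)

theorem isLift_monomialLift (hK : ∀ r : ℝ, ((fun t : ℝ => t ^ r : ℝ → ℝ) :
      Germ (atTop : Filter ℝ) ℝ) ∈ K) {c : Fin d → Fin m → ℕ} (hc : ∀ i j, 0 < c i j) :
    IsLift K A (monomialLift A c) := by
  refine ⟨fun i j => ?_, fun i j => ?_, fun i j => ?_⟩
  · unfold monomialLift
    induction A i j using WithBot.recBotCoe with
    | bot =>
      simp only [WithBot.recBotCoe_bot, mul_zero]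
      exact K.zero_mem
    | coe r => exact K.mul_mem (natCast_mem K (c i j)) (hK r)
  · filter_upwards [eventually_gt_atTop 0] with t ht
    unfold monomialLift
    induction A i j using WithBot.recBotCoe with
    | bot => simp
    | coe r => exact mul_nonneg (Nat.cast_nonneg _) (Real.rpow_nonneg ht.le r)
  · unfold monomialLift
    induction A i j using WithBot.recBotCoe with
    | bot =>
      simp only [WithBot.recBotCoe_bot, mul_zero]
      exact hasVal_zero
    | coe r => exact hasVal_const_mul_rpow (by exact_mod_cast hc i j) r

theorem monomialLift_nonneg (c : Fin d → Fin m → ℕ) (i : Fin d) (j : Fin m) {t : ℝ} (ht : 0 ≤ t) :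
    0 ≤ monomialLift A c i j t := by
  unfold monomialLift
  induction A i j using WithBot.recBotCoe with
  | bot => simp
  | coe r => exact mul_nonneg (Nat.cast_nonneg _) (Real.rpow_nonneg ht r)

theorem prod_monomialLift (c : Fin d → Fin m → ℕ) (f : Fin d → Fin m) {t : ℝ} (ht : 0 < t) :
    ∏ i, monomialLift A c i (f i) t =
      (∏ i, (c i (f i) : ℝ)) * (∑ i, A i (f i)).recBotCoe 0 (fun r => t ^ r) := by
  unfold monomialLift
  rw [Finset.prod_mul_distrib]
  congr 1
  induction (Finset.univ : Finset (Fin d)) using Finset.induction_on with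
  | empty =>
    simp only [Finset.prod_empty, Finset.sum_empty]
    exact (Real.rpow_zero t).symm
  | insert a s ha ih =>
    rw [Finset.prod_insert ha, Finset.sum_insert ha, ih]
    generalize ∑ i ∈ s, A i (f i) = y
    generalize A a (f a) = x
    induction x using WithBot.recBotCoe with
    | bot => simp
    | coe x =>
      induction y using WithBot.recBotCoe with
      | bot => simp
      | coe y => exact (Real.rpow_add ht x y).symm

theorem recBotCoe_rpow_le {x : WithBot ℝ} {v : ℝ} (h : x ≤ (v : WithBot ℝ)) {t : ℝ} (ht : 1 ≤ t) :
    (x.recBotCoe 0 (fun r => t ^ r) : ℝ) ≤ t ^ v := by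
  induction x using WithBot.recBotCoe with
  | bot => exact Real.rpow_nonneg (by linarith) v
  | coe x => exact Real.rpow_le_rpow_of_exponent_le ht (WithBot.coe_le_coe.1 h)

/-- Non-negativity of the entries does not prevent cancellation in the determinant, since the signs
of the Leibniz terms differ. Large coefficients along the optimal injection `f` make one term
dominate, even if other injections have the same weight. -/
theorem qvolPlus_eq_coe (hK : ∀ r : ℝ, ((fun t : ℝ => t ^ r : ℝ → ℝ) :
      Germ (atTop : Filter ℝ) ℝ) ∈ K) (hdm : d < m) {v : ℝ} (f : Fin d ↪ Fin m)
    (hf : ∑ i, A i (f i) = (v : WithBot ℝ))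
    (hv : ∀ g : Fin d ↪ Fin m, ∑ i, A i (g i) ≤ (v : WithBot ℝ)) :
    qvolPlus K A = (v : EReal) := by
  refine le_antisymm (sSup_le ?_) (le_sSup ?_)
  · rintro w ⟨a, ha, hw⟩
    exact ha.val_volConv_le hw fun _ => hv
  -- an additional column
  obtain ⟨j₀, hj₀⟩ : ∃ j₀, j₀ ∉ Set.range f := by
    by_contra! hall
    have := Fintype.card_le_of_surjective f hall
    simp only [Fintype.card_fin] at this
    omega
  -- `N` is the number of Leibniz terms, so a term that is `N` times larger than each of the others
  -- exceeds the sum of the rest.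
  set N : ℕ := (d + 1).factorial with hN
  have hN1 : 1 ≤ N := Nat.factorial_pos _
  set c : Fin d → Fin m → ℕ := fun i j => if j = f i then N else 1 with hc
  have hc1 : ∀ i j, 1 ≤ c i j := fun i j => by simp only [hc]; split_ifs <;> omega
  have hcN : ∀ i j, c i j ≤ N := fun i j => by simp only [hc]; split_ifs <;> omega
  refine ⟨monomialLift A c, isLift_monomialLift hK fun i j => hc1 i j, ?_⟩
  set g : Fin (d + 1) → Fin m := Fin.cons j₀ f with hg
  have hginj : Function.Injective g := Fin.cons_injective_iff.2 ⟨hj₀, f.injective⟩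
  -- the determinant of the simplex
  have hdet : ∀ t : ℝ, 1 < t →
      (1 / N : ℝ) * t ^ v ≤ (homogenization (fun i j => monomialLift A c i j t) g).det := by
    intro t ht
    have ht0 : 0 < t := by linarith
    have htv : 0 < t ^ v := Real.rpow_pos_of_pos ht0 v
    have hNr : (1 : ℝ) ≤ N := by exact_mod_cast hN1
    rw [det_homogenization]
    have hone : ((Equiv.Perm.sign (1 : Equiv.Perm (Fin (d + 1))) : ℤ) : ℝ) *
        ∏ i : Fin d, monomialLift A c i (g ((1 : Equiv.Perm (Fin (d + 1))) i.succ)) t =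
        N ^ d * t ^ v := by
      have : ∀ i : Fin d, g ((1 : Equiv.Perm (Fin (d + 1))) i.succ) = f i := fun i => by simp [hg]
      simp only [this, Equiv.Perm.sign_one, Units.val_one, Int.cast_one, one_mul]
      rw [prod_monomialLift c f ht0, hf]
      simp [hc]
    have hother : ∀ σ ∈ Finset.univ.erase (1 : Equiv.Perm (Fin (d + 1))),
        -(N ^ d * t ^ v / N) ≤ ((Equiv.Perm.sign σ : ℤ) : ℝ) *
          ∏ i : Fin d, monomialLift A c i (g (σ i.succ)) t := by
      intro σ hσ
      have hσ1 : σ ≠ 1 := (Finset.mem_erase.1 hσ).1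
      -- A permutation that fixes all successors fixes $0$ as well. At the successor that is moved,
      -- the coefficient is $1$ instead of `N`.
      obtain ⟨i₀, hi₀⟩ : ∃ i : Fin d, σ i.succ ≠ i.succ := by
        by_contra! hall
        refine hσ1 (Equiv.ext fun k => ?_)
        cases k using Fin.cases with
        | succ i => exact hall i
        | zero =>
          rcases Fin.eq_zero_or_eq_succ (σ 0) with h | ⟨i, h⟩
          · exact h
          · exact absurd (σ.injective (h.trans (hall i).symm)) (Fin.succ_ne_zero i).symm
      refine (neg_le_neg ?_).trans (neg_abs_le _)
      rw [abs_mul, ← Int.cast_abs, Equiv.Perm.sign_abs, Int.cast_one, one_mul,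
        abs_of_nonneg (Finset.prod_nonneg fun i _ => monomialLift_nonneg c _ _ ht0.le),
        prod_monomialLift c (fun i => g (σ i.succ)) ht0, le_div_iff₀ (by linarith)]
      have h1 : (∏ i, (c i (g (σ i.succ)) : ℝ)) * N ≤ N ^ d := by
        rw [← Finset.mul_prod_erase _ _ (Finset.mem_univ i₀)]
        have : c i₀ (g (σ i₀.succ)) = 1 := by
          simp only [hc]
          rw [if_neg]
          intro h
          exact hi₀ (hginj (h.trans (by simp [hg])))
        rw [this, Nat.cast_one, one_mul]
        calc (∏ i ∈ Finset.univ.erase i₀, (c i (g (σ i.succ)) : ℝ)) * N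
            ≤ (∏ _i ∈ Finset.univ.erase i₀, (N : ℝ)) * N := by
              gcongr with i
              exact hcN _ _
          _ = ∏ _i : Fin d, (N : ℝ) := Finset.prod_erase_mul _ _ (Finset.mem_univ i₀)
          _ = N ^ d := by simp
      have h2 := recBotCoe_rpow_le (hv ⟨fun i => g (σ i.succ),
        hginj.comp (σ.injective.comp (Fin.succ_injective d))⟩) ht.le
      have h3 : (0 : ℝ) ≤ ∏ i, (c i (g (σ i.succ)) : ℝ) :=
        Finset.prod_nonneg fun _ _ => Nat.cast_nonneg _
      calc _ ≤ (∏ i, (c i (g (σ i.succ)) : ℝ)) * t ^ v * N := by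
            gcongr
            exact h2
        _ = (∏ i, (c i (g (σ i.succ)) : ℝ)) * N * t ^ v := by ring
        _ ≤ N ^ d * t ^ v := by gcongr
    rw [← Finset.add_sum_erase _ _ (Finset.mem_univ (1 : Equiv.Perm (Fin (d + 1)))), hone]
    have hsum := Finset.card_nsmul_le_sum _ _ _ hother
    have hcard : (Finset.univ.erase (1 : Equiv.Perm (Fin (d + 1)))).card = N - 1 := by
      rw [Finset.card_erase_of_mem (Finset.mem_univ _), Finset.card_univ, Fintype.card_perm,
        Fintype.card_fin]
    rw [hcard, nsmul_eq_mul, Nat.cast_sub hN1, Nat.cast_one] at hsum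
    have hNd : (1 : ℝ) ≤ N ^ d := one_le_pow₀ hNr
    have hkey : (1 / N : ℝ) * t ^ v ≤ N ^ d * t ^ v / N := by
      rw [one_div, inv_mul_eq_div]
      gcongr
      nlinarith
    -- The dominant term minus `N - 1` terms of size $N^{d-1}t^v$ leaves exactly $N^{d-1}t^v$.
    have hid : (N ^ d * t ^ v : ℝ) + (N - 1) * -(N ^ d * t ^ v / N) = N ^ d * t ^ v / N := by
      field_simp
      ring
    linarith
  have hC : (0 : ℝ) < (m ^ (d + 1) * (d + 1).factorial : ℕ) * N ^ d := by
    have : 0 < m := by omega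
    positivity
  have hc0 : (0 : ℝ) < 1 / N * (1 / (d + 1 : ℝ)) ^ d := by positivity
  refine (hasVal_const_mul_rpow hc0 v).squeeze (hasVal_const_mul_rpow hC v) ?_ ?_
  · filter_upwards [eventually_gt_atTop 1] with t ht
    have htv : 0 < t ^ v := Real.rpow_pos_of_pos (by linarith) v
    rw [abs_of_pos (mul_pos hc0 htv), volConv, abs_of_nonneg measureReal_nonneg]
    refine le_trans ?_ (le_volume_convexHull _ g)
    rw [mul_right_comm]
    gcongr
    exact (hdet t ht).trans (le_abs_self _)
  · filter_upwards [eventually_gt_atTop 1] with t ht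
    have ht0 : 0 < t := by linarith
    have htv : 0 < t ^ v := Real.rpow_pos_of_pos ht0 v
    rw [abs_of_pos (mul_pos hC htv), volConv, abs_of_nonneg measureReal_nonneg, mul_assoc]
    refine volume_convexHull_le_of_prod_le (fun i j => monomialLift A c i j t) (by positivity)
      fun _ h => ?_
    simp only [abs_of_nonneg (monomialLift_nonneg c _ _ ht0.le)]
    rw [prod_monomialLift c h ht0]
    have h1 : (∏ i, (c i (h i) : ℝ)) ≤ N ^ d := by
      calc (∏ i, (c i (h i) : ℝ)) ≤ ∏ _i : Fin d, (N : ℝ) := by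
            gcongr with i
            exact hcN _ _
        _ = N ^ d := by simp
    calc _ ≤ (∏ i, (c i (h i) : ℝ)) * t ^ v := by
          gcongr
          exact recBotCoe_rpow_le (hv h) ht.le
      _ ≤ _ := by gcongr

end

/-! ### The Hungarian method: invariants

Matrices of size `m × m` are stored row by row, with `c (i * m + j)` the slack of the pair `(i, j)`.
The partial matching is given by `col` (the column of a matched row) and `row` (one plus the row of
a matched column, and zero for a free column). -/

theorem mul_add_inj {m i j i' j' : ℕ} (hj : j < m) (hj' : j' < m) :
    i * m + j = i' * m + j' ↔ i = i' ∧ j = j' := by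
  refine ⟨fun h => ?_, by rintro ⟨rfl, rfl⟩; rfl⟩
  have hm : 0 < m := by omega
  have h1 : (i * m + j) / m = i := by
    rw [mul_comm, Nat.mul_add_div hm, Nat.div_eq_of_lt hj, add_zero]
  have h2 : (i' * m + j') / m = i' := by
    rw [mul_comm, Nat.mul_add_div hm, Nat.div_eq_of_lt hj', add_zero]
  have : i = i' := by rw [← h1, h, h2]
  subst this
  exact ⟨rfl, by omega⟩

/-- The matrix `c` is non-negative, and the weights of permutations with respect to `c` and `c₀`
differ by a constant. -/
structure IsSlack (m : ℕ) (c₀ c : ℕ → ℝ) : Prop where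
  nonneg : ∀ i < m, ∀ j < m, 0 ≤ c (i * m + j)
  uniform : ∃ z : ℝ, ∀ σ : Equiv.Perm (Fin m),
    ∑ i : Fin m, c (i * m + σ i) = ∑ i : Fin m, c₀ (i * m + σ i) + z

/-- A matching of the first `k` rows by pairs without slack, where the column `b` is disregarded. -/
structure IsMatching (m k : ℕ) (c : ℕ → ℝ) (col row : ℕ → ℕ) : Prop where
  col_lt : ∀ i < k, col i < m
  row_col : ∀ i < k, row (col i) = i + 1
  row_le : ∀ j < m, 0 < row j → row j ≤ k ∧ col (row j - 1) = j
  tight : ∀ i < k, c (i * m + col i) = 0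

/-- The edge from the column `j` to its predecessor in the alternating tree. -/
structure IsParent (m : ℕ) (c : ℕ → ℝ) (S way : ℕ → ℕ) (j : ℕ) : Prop where
  lt : way j < m
  mem : 0 < S (way j)
  tight : c (way j * m + j) = 0

/-- An alternating tree with root `k`, with rows `S`, columns `T`, and `l` columns. -/
structure IsTree (m k l : ℕ) (c : ℕ → ℝ) (S T way col row rank : ℕ → ℕ) : Prop where
  root : 0 < S k
  le_root : ∀ i < m, 0 < S i → i ≤ k
  row_mem : ∀ j < m, 0 < T j → 0 < row j ∧ 0 < S (row j - 1)
  col_mem : ∀ i < k, 0 < S i → 0 < T (col i)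
  parent : ∀ i < k, 0 < S i → IsParent m c S way (col i) ∧ rank (way (col i)) < rank i
  rank_le : ∀ i < m, 0 < S i → rank i ≤ l
  card : ((Finset.range m).filter fun j => 0 < T j).card = l

/-- The situation during the augmentation of a matching of the first `k` rows along a path in the
tree: the column `b` is to be matched to its predecessor. -/
structure IsAugmentation (m k : ℕ) (c : ℕ → ℝ) (S way col row rank : ℕ → ℕ) (b : ℕ) : Prop where
  lt : b < m
  le_root : ∀ i < m, 0 < S i → i ≤ k
  col_ne : ∀ i < k, col i ≠ b
  col_lt : ∀ i < k, col i < m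
  row_col : ∀ i < k, row (col i) = i + 1
  row_le : ∀ j < m, j ≠ b → 0 < row j → row j ≤ k ∧ col (row j - 1) = j
  tight : ∀ i < k, c (i * m + col i) = 0
  parent : IsParent m c S way b
  path : ∀ i < k, 0 < S i → rank i ≤ rank (way b) →
    IsParent m c S way (col i) ∧ rank (way (col i)) < rank i

/-! ### Changes of the slacks, the tree and the matching -/

section

variable {m k l : ℕ} {c₀ c : ℕ → ℝ} {S T way col row rank : ℕ → ℕ}

/-- Columns of the tree are matched, injectively, to the first `k` rows, so they cannot be all `m >
k` columns. -/
theorem IsTree.exists_column (ht : IsTree m k l c S T way col row rank)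
    (hm : IsMatching m k c col row) (hk : k < m) : ∃ j < m, T j = 0 := by
  by_contra! h
  have h' : ∀ j < m, 0 < row j := fun j hj => (ht.row_mem j hj (Nat.pos_of_ne_zero (h j hj))).1
  have hcard := Finset.card_le_card_of_injOn (s := Finset.range m) (t := Finset.range k)
    (fun j => row j - 1) (fun j hj => by
      have hj := Finset.mem_range.1 hj
      have h1 := (hm.row_le j hj (h' j hj)).1
      have h2 := h' j hj
      simp only [Finset.coe_range, Set.mem_Iio]
      omega) (fun j hj j' hj' he => by
      have hj := Finset.mem_range.1 hj
      have hj' := Finset.mem_range.1 hj'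
      rw [← (hm.row_le j hj (h' j hj)).2, ← (hm.row_le j' hj' (h' j' hj')).2]
      exact congrArg col he)
  simp only [Finset.card_range] at hcard
  omega

theorem IsTree.le (ht : IsTree m k l c S T way col row rank) : l ≤ m := by
  have := Finset.card_filter_le (Finset.range m) fun j => 0 < T j
  rwa [ht.card, Finset.card_range] at this

/-- The change of the slacks of all pairs when `δ` is subtracted from the rows in `S` and added to
the columns in `T`. -/
noncomputable def slackChange (S T : ℕ → ℕ) (δ : ℝ) (i j : ℕ) : ℝ :=
  (if 0 < S i then -δ else 0) + if 0 < T j then δ else 0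

/-- A slack decreases only for a row in `S` and a column outside `T`, where `δ` is at most the
slack. A permutation meets every row and every column once, so its weight changes by an amount
independent of the permutation. -/
theorem IsSlack.change {c' : ℕ → ℝ} (hs : IsSlack m c₀ c) {δ : ℝ} (hδ : 0 ≤ δ)
    (hmin : ∀ i < m, ∀ j < m, 0 < S i → T j = 0 → δ ≤ c (i * m + j))
    (hc' : ∀ i < m, ∀ j < m, c' (i * m + j) = c (i * m + j) + slackChange S T δ i j) :
    IsSlack m c₀ c' := by
  refine ⟨fun i hi j hj => ?_, ?_⟩
  · rw [hc' i hi j hj, slackChange]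
    have h0 := hs.nonneg i hi j hj
    split_ifs with h1 h2 h2
    · linarith
    · linarith [hmin i hi j hj h1 (by omega)]
    · linarith
    · linarith
  · obtain ⟨z, hz⟩ := hs.uniform
    refine ⟨z + ((∑ i : Fin m, if 0 < S i then -δ else 0) + ∑ j : Fin m, if 0 < T j then δ else 0),
      fun σ => ?_⟩
    rw [← Equiv.sum_comp σ fun j : Fin m => if 0 < T j then δ else 0, ← add_assoc, ← hz σ,
      ← Finset.sum_add_distrib, ← Finset.sum_add_distrib]
    exact Finset.sum_congr rfl fun i _ => hc' i i.2 (σ i) (σ i).2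

theorem IsTree.mem_iff (ht : IsTree m k l c S T way col row rank)
    (hm : IsMatching m k c col row) {i : ℕ} (hi : i < k) : 0 < S i ↔ 0 < T (col i) := by
  refine ⟨ht.col_mem i hi, fun h => ?_⟩
  have := (ht.row_mem (col i) (hm.col_lt i hi) h).2
  rwa [hm.row_col i hi, Nat.add_sub_cancel] at this

/-- A matched row is in `S` exactly if its column is in `T`, so the two changes cancel or are both
absent. -/
theorem IsMatching.change {c' : ℕ → ℝ} (hm : IsMatching m k c col row)
    (ht : IsTree m k l c S T way col row rank) (hk : k < m) {δ : ℝ}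
    (hc' : ∀ i < m, ∀ j < m, c' (i * m + j) = c (i * m + j) + slackChange S T δ i j) :
    IsMatching m k c' col row := by
  refine ⟨hm.col_lt, hm.row_col, hm.row_le, fun i hi => ?_⟩
  rw [hc' i (by omega) _ (hm.col_lt i hi), hm.tight i hi, slackChange]
  have := ht.mem_iff hm hi
  split_ifs <;> first | ring1 | tauto

/-- Tree edges join a row in `S` to a column in `T`, where the two changes cancel. -/
theorem IsTree.change {c' : ℕ → ℝ} (ht : IsTree m k l c S T way col row rank)
    (hm : IsMatching m k c col row) {δ : ℝ}
    (hc' : ∀ i < m, ∀ j < m, c' (i * m + j) = c (i * m + j) + slackChange S T δ i j) :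
    IsTree m k l c' S T way col row rank := by
  refine ⟨ht.root, ht.le_root, ht.row_mem, ht.col_mem, fun i hi hSi => ?_, ht.rank_le, ht.card⟩
  obtain ⟨⟨h1, h2, h3⟩, h4⟩ := ht.parent i hi hSi
  refine ⟨⟨h1, h2, ?_⟩, h4⟩
  rw [hc' _ h1 _ (hm.col_lt i hi), h3, slackChange, if_pos h2, if_pos (ht.col_mem i hi hSi)]
  ring

/-- The column `j` enters together with the row matched to it. That row gets the rank `l + 1`,
larger than all earlier ranks, so ranks decrease towards the root. -/
theorem IsTree.grow (ht : IsTree m k l c S T way col row rank) (hm : IsMatching m k c col row)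
    {i j : ℕ} (hi : i < m) (hj : j < m) (hS : 0 < S i) (hT : T j = 0)
    (hc : c (i * m + j) = 0) (hrow : 0 < row j) :
    IsTree m k (l + 1) c (Function.update S (row j - 1) 1) (Function.update T j 1)
      (Function.update way j i) col row (Function.update rank (row j - 1) (l + 1)) := by
  obtain ⟨hrk, hcol⟩ := hm.row_le j hj hrow
  set r := row j - 1 with hr
  have hrlt : r < k := by omega
  -- The row is new: otherwise its matched column `j` would already be in `T`.
  have hrS : S r = 0 := by
    by_contra h
    have := ht.col_mem r hrlt (Nat.pos_of_ne_zero h)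
    rw [hcol] at this
    omega
  have hSmono : ∀ x, 0 < S x → 0 < Function.update S r 1 x := by
    intro x hx
    rw [Function.update_apply]
    split_ifs <;> omega
  have hSinv : ∀ x, 0 < Function.update S r 1 x → x ≠ r → 0 < S x := by
    intro x hx hne
    rwa [Function.update_of_ne hne] at hx
  have hne : ∀ x, 0 < S x → x ≠ r := by
    rintro x hx rfl
    omega
  refine ⟨hSmono k ht.root, fun x hx hSx => ?_, fun y hy hTy => ?_, fun x hx hSx => ?_,
    fun x hx hSx => ?_, fun x hx hSx => ?_, ?_⟩
  · by_cases h : x = r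
    · omega
    · exact ht.le_root x hx (hSinv x hSx h)
  · by_cases h : y = j
    · subst h
      exact ⟨hrow, by simp [hr]⟩
    · rw [Function.update_of_ne h] at hTy
      exact ⟨(ht.row_mem y hy hTy).1, hSmono _ (ht.row_mem y hy hTy).2⟩
  · by_cases h : x = r
    · rw [h, hcol, Function.update_self]
      exact Nat.one_pos
    · have := ht.col_mem x hx (hSinv x hSx h)
      rw [Function.update_apply]
      split_ifs <;> omega
  · by_cases h : x = r
    · subst h
      rw [hcol]
      refine ⟨⟨?_, ?_, ?_⟩, ?_⟩ <;> rw [Function.update_self]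
      · exact hi
      · exact hSmono i hS
      · exact hc
      · rw [Function.update_self, Function.update_of_ne (hne i hS)]
        exact Nat.lt_succ_of_le (ht.rank_le i hi hS)
    · have hSx' := hSinv x hSx h
      have hne' : col x ≠ j := by
        intro h'
        have := ht.col_mem x hx hSx'
        rw [h'] at this
        omega
      obtain ⟨⟨h1, h2, h3⟩, h4⟩ := ht.parent x hx hSx'
      refine ⟨⟨?_, ?_, ?_⟩, ?_⟩ <;> rw [Function.update_of_ne hne']
      · exact h1
      · exact hSmono _ h2
      · exact h3
      · rwa [Function.update_of_ne h, Function.update_of_ne (hne _ h2)]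
  · by_cases h : x = r
    · rw [h, Function.update_self]
    · rw [Function.update_of_ne h]
      exact (ht.rank_le x hx (hSinv x hSx h)).trans (Nat.le_succ l)
  · have : ((Finset.range m).filter fun y => 0 < Function.update T j 1 y) =
        insert j ((Finset.range m).filter fun y => 0 < T y) := by
      ext y
      simp only [Finset.mem_filter, Finset.mem_range, Finset.mem_insert, Function.update_apply]
      by_cases h : y = j
      · simp [h, hj]
      · simp [h]
    rw [this, Finset.card_insert_of_notMem (by simp [hT]), ht.card]

/-- As `j` is free, it is not the column of a matched row, so the new pointer at `j` leaves the
pointers of the tree intact. -/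
theorem IsTree.isAugmentation (ht : IsTree m k l c S T way col row rank)
    (hm : IsMatching m k c col row) {i j : ℕ} (hi : i < m) (hj : j < m) (hS : 0 < S i)
    (hc : c (i * m + j) = 0) (hrow : row j = 0) :
    IsAugmentation m k c S (Function.update way j i) col row rank j := by
  have hne : ∀ x < k, col x ≠ j := by
    rintro x hx rfl
    have := hm.row_col x hx
    omega
  refine ⟨hj, ht.le_root, hne, hm.col_lt, hm.row_col, fun y hy _ => hm.row_le y hy, hm.tight,
    ⟨?_, ?_, ?_⟩, fun x hx hSx _ => ?_⟩
  · rwa [Function.update_self]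
  · rwa [Function.update_self]
  · rwa [Function.update_self]
  · obtain ⟨⟨h1, h2, h3⟩, h4⟩ := ht.parent x hx hSx
    refine ⟨⟨?_, ?_, ?_⟩, ?_⟩ <;> rwa [Function.update_of_ne (hne x hx)]

/-- Matching `b` to its predecessor releases the former column of that row, which becomes the next
`b`. The entry of `row` at the released column is out of date, which is why the invariant ignores
`b` there. -/
theorem IsAugmentation.next {b : ℕ} (h : IsAugmentation m k c S way col row rank b)
    (hb : way b < k) :
    IsAugmentation m k c S way (Function.update col (way b) b) (Function.update row b (way b + 1))
      rank (col (way b)) ∧ rank (way (col (way b))) < rank (way b) := by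
  obtain ⟨hpar, hrank⟩ := h.path (way b) hb h.parent.mem le_rfl
  have hinj : ∀ i < k, i ≠ way b → col i ≠ col (way b) := by
    intro i hi hne he
    have h1 := h.row_col i hi
    rw [he, h.row_col _ hb] at h1
    omega
  refine ⟨⟨h.col_lt _ hb, h.le_root, fun i hi => ?_, fun i hi => ?_, fun i hi => ?_,
    fun j hj hjb hr => ?_, fun i hi => ?_, hpar, fun i hi hSi hri => ?_⟩, hrank⟩
  · by_cases hi' : i = way b
    · rw [hi', Function.update_self]
      exact (h.col_ne _ hb).symm
    · rw [Function.update_of_ne hi']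
      exact hinj i hi hi'
  · by_cases hi' : i = way b
    · rw [hi', Function.update_self]
      exact h.lt
    · rw [Function.update_of_ne hi']
      exact h.col_lt i hi
  · by_cases hi' : i = way b
    · rw [hi', Function.update_self, Function.update_self]
    · rw [Function.update_of_ne hi', Function.update_of_ne (h.col_ne i hi)]
      exact h.row_col i hi
  · by_cases hj' : j = b
    · subst hj'
      rw [Function.update_self, Nat.add_sub_cancel, Function.update_self]
      exact ⟨hb, rfl⟩
    · rw [Function.update_of_ne hj'] at hr ⊢
      obtain ⟨h1, h2⟩ := h.row_le j hj hj' hr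
      refine ⟨h1, ?_⟩
      rw [Function.update_of_ne, h2]
      intro he
      rw [he] at h2
      exact hjb h2.symm
  · by_cases hi' : i = way b
    · rw [hi', Function.update_self]
      exact h.parent.tight
    · rw [Function.update_of_ne hi']
      exact h.tight i hi
  · have hi' : i ≠ way b := by
      rintro rfl
      omega
    rw [Function.update_of_ne hi']
    exact h.path i hi hSi (by omega)

theorem IsAugmentation.isMatching {b : ℕ} (h : IsAugmentation m k c S way col row rank b)
    (hb : ¬ way b < k) :
    IsMatching m (k + 1) c (Function.update col (way b) b)
      (Function.update row b (way b + 1)) := by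
  have hk : way b = k := le_antisymm (h.le_root _ h.parent.lt h.parent.mem) (not_lt.1 hb)
  have htight := h.parent.tight
  rw [hk] at htight ⊢
  refine ⟨fun i hi => ?_, fun i hi => ?_, fun j hj hr => ?_, fun i hi => ?_⟩
  · by_cases hi' : i = k
    · rw [hi', Function.update_self]
      exact h.lt
    · rw [Function.update_of_ne hi']
      exact h.col_lt i (by omega)
  · by_cases hi' : i = k
    · rw [hi', Function.update_self, Function.update_self]
    · rw [Function.update_of_ne hi', Function.update_of_ne (h.col_ne i (by omega))]
      exact h.row_col i (by omega)
  · by_cases hj' : j = b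
    · subst hj'
      rw [Function.update_self, Nat.add_sub_cancel, Function.update_self]
      exact ⟨le_rfl, rfl⟩
    · rw [Function.update_of_ne hj'] at hr ⊢
      obtain ⟨h1, h2⟩ := h.row_le j hj hj' hr
      refine ⟨by omega, ?_⟩
      rw [Function.update_of_ne (by omega), h2]
  · by_cases hi' : i = k
    · rw [hi', Function.update_self]
      exact htight
    · rw [Function.update_of_ne hi']
      exact h.tight i (by omega)

/-- A perfect matching by pairs without slack is a permutation of minimal weight. -/
theorem IsMatching.exists_perm (hm : IsMatching m m c col row) (hs : IsSlack m c₀ c) :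
    ∃ σ : Equiv.Perm (Fin m), (∀ i, (σ i : ℕ) = col i) ∧ ∀ τ : Equiv.Perm (Fin m),
      ∑ i : Fin m, c₀ (i * m + σ i) ≤ ∑ i : Fin m, c₀ (i * m + τ i) := by
  have hinj : Function.Injective fun i : Fin m => (⟨col i, hm.col_lt i i.2⟩ : Fin m) := by
    intro i j hij
    have h1 := hm.row_col i i.2
    rw [show col i = col j from congrArg Fin.val hij, hm.row_col j j.2] at h1
    exact Fin.ext (by omega)
  refine ⟨Equiv.ofBijective _ (Finite.injective_iff_bijective.1 hinj), fun i => rfl, fun τ => ?_⟩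
  set σ : Equiv.Perm (Fin m) := Equiv.ofBijective _ (Finite.injective_iff_bijective.1 hinj) with hσ
  obtain ⟨z, hz⟩ := hs.uniform
  have h1 := hz σ
  have h2 := hz τ
  have h3 : ∑ i : Fin m, c (i * m + σ i) = 0 := Finset.sum_eq_zero fun i _ => hm.tight i i.2
  -- With respect to `c` the matching has weight zero and every permutation has non-negative weight;
  -- the common shift `z` transfers this comparison to `c₀`.
  have h4 : 0 ≤ ∑ i : Fin m, c (i * m + τ i) :=
    Finset.sum_nonneg fun i _ => hs.nonneg i i.2 (τ i) (τ i).2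
  linarith

end

/-! ### The program

Index variables: `0`, `1` hold `d`, `m`; `2` is the current row; `3`, `4` are counters; `5`, `6` hold
the row and column of an edge; `7` tells if an edge was found; `8` tells if a free column or the
root was reached. Index arrays: `0` marks finite entries; `1` is for output; `2`, `3` mark the rows
and columns of the tree; `4` holds predecessors in the tree; `5`, `6` hold the matching. Number
arrays: `0` holds the entries; `1` is for output; `2` holds slacks; `3` the sum of the absolute
values of the entries; `4` the minimal slack; `5` the number zero; `6` the slack of an entry
`-∞`. -/

/-- The position `i * m + e`, for the value `i` of the variable `x`. -/
def position (x : ℕ) (e : IndexExpr) : IndexExpr := .add (.mul (.var x) (.var 1)) e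

/-- Add up the absolute values of the entries. -/
def absSum : Program :=
  .for 3 (.mul (.var 0) (.var 1))
    (.cond (.numLE 5 (.const 0) 0 (.var 3))
      (.setNum .add 3 (.const 0) 3 (.const 0) 0 (.var 3))
      (.setNum .sub 3 (.const 0) 3 (.const 0) 0 (.var 3)))

/-- Compute a slack for the entries `-∞`. -/
def largeSlack : Program :=
  .seq (.setConst 6 (.const 0) 1)
    (.seq (.setNum .add 6 (.const 0) 6 (.const 0) 3 (.const 0))
      (.seq (.setNum .add 6 (.const 0) 6 (.const 0) 3 (.const 0))
        (.setNum .add 6 (.const 0) 6 (.const 0) 3 (.const 0))))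

/-- Set up the square matrix of slacks. -/
def initSlack : Program :=
  .for 3 (.mul (.var 1) (.var 1))
    (.cond (.indexLT (.var 3) (.mul (.var 0) (.var 1)))
      (.cond (.indexLT (.const 0) (.cell 0 (.var 3)))
        (.setNum .sub 2 (.var 3) 3 (.const 0) 0 (.var 3))
        (.copyNum 2 (.var 3) 6 (.const 0)))
      .skip)

/-- One step in the search for the minimal slack between rows in the tree and other columns. -/
def minSearchStep : Program :=
  .cond (.both (.both (.indexLT (.const 0) (.cell 2 (.var 3)))
      (.neg (.indexLT (.const 0) (.cell 3 (.var 4)))))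
      (.neg (.both (.indexLT (.const 0) (.var 7)) (.numLE 4 (.const 0) 2 (position 3 (.var 4))))))
    (.seq (.setVar 5 (.var 3)) (.seq (.setVar 6 (.var 4)) (.seq (.setVar 7 (.const 1))
      (.copyNum 4 (.const 0) 2 (position 3 (.var 4))))))
    .skip

/-- Find the minimal slack between rows in the tree and other columns. -/
def minSearch : Program :=
  .seq (.setVar 7 (.const 0)) (.for 3 (.var 1) (.for 4 (.var 1) minSearchStep))

/-- Change one slack. -/
def changeSlackStep : Program :=
  .cond (.indexLT (.const 0) (.cell 2 (.var 3)))
    (.cond (.indexLT (.const 0) (.cell 3 (.var 4))) .skip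
      (.setNum .sub 2 (position 3 (.var 4)) 2 (position 3 (.var 4)) 4 (.const 0)))
    (.cond (.indexLT (.const 0) (.cell 3 (.var 4)))
      (.setNum .add 2 (position 3 (.var 4)) 2 (position 3 (.var 4)) 4 (.const 0)) .skip)

/-- Subtract the minimal slack from the rows in the tree and add it to the columns in the tree. -/
def changeSlack : Program :=
  .for 3 (.var 1) (.for 4 (.var 1) changeSlackStep)

/-- Add an edge to the tree, or stop if it ends in a free column. -/
def grow : Program :=
  .seq (.setCell 4 (.var 6) (.var 5))
    (.cond (.indexLT (.const 0) (.cell 6 (.var 6)))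
      (.seq (.setCell 3 (.var 6) (.const 1))
        (.setCell 2 (.sub (.cell 6 (.var 6)) (.const 1)) (.const 1)))
      (.setVar 8 (.const 1)))

/-- Start a tree from the current row. -/
def initTree : Program :=
  .seq (.for 4 (.var 1)
      (.seq (.setCell 2 (.var 4) (.const 0)) (.setCell 3 (.var 4) (.const 0))))
    (.seq (.setCell 2 (.var 2) (.const 1)) (.setVar 8 (.const 0)))

/-- Grow a tree until it reaches a free column. -/
def growTree : Program :=
  .loop (.indexLT (.var 8) (.const 1)) (.seq minSearch (.seq changeSlack grow))

/-- One step of the augmentation of the matching. -/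
def augmentStep : Program :=
  .seq (.setVar 5 (.cell 4 (.var 6)))
    (.seq (.setVar 9 (.cell 5 (.var 5)))
      (.seq (.setCell 5 (.var 5) (.var 6))
        (.seq (.setCell 6 (.var 6) (.add (.var 5) (.const 1)))
          (.cond (.indexLT (.var 5) (.var 2)) (.setVar 6 (.var 9)) (.setVar 8 (.const 1))))))

/-- Augment the matching along a path in the tree. -/
def augment : Program :=
  .seq (.setVar 8 (.const 0)) (.loop (.indexLT (.var 8) (.const 1)) augmentStep)

/-- Match all rows, one after the other. -/
def matchRows : Program :=
  .for 2 (.var 1) (.seq initTree (.seq growTree augment))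

/-- Add up the matched entries. -/
def sumMatched : Program :=
  .seq (.setCell 1 (.const 0) (.const 1))
    (.for 3 (.var 0)
      (.cond (.indexLT (.const 0) (.cell 0 (position 3 (.cell 5 (.var 3)))))
        (.setNum .add 1 (.const 0) 1 (.const 0) 0 (position 3 (.cell 5 (.var 3))))
        (.setCell 1 (.const 0) (.const 0))))

/-- The program which computes the upper dequantized volume by the Hungarian method. -/
def hungarian : Program :=
  .cond (.indexLT (.var 0) (.var 1))
    (.seq absSum (.seq largeSlack (.seq initSlack (.seq matchRows sumMatched))))
    .skip

theorem isTame_hungarian : hungarian.isTame := by decide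

/-! ### Correctness of the parts of the program -/

section

variable {n : ℕ} {s : Store}

theorem absSum_spec (h0 : s.var 0 ≤ n) (h1 : s.var 1 ≤ n) (h5 : s.num 5 0 = 0) :
    WP n absSum s fun s' =>
      s'.num 3 0 = s.num 3 0 + ∑ x ∈ Finset.range (s.var 0 * s.var 1), |s.num 0 x| := by
  refine WP.for (fun i s' => s'.num 3 0 = s.num 3 0 + ∑ x ∈ Finset.range i, |s.num 0 x|)
    (s.var 0 * s.var 1) (by nlinarith) (by decide) (fun s' hf => ?_) ?_
    (fun i s' hi hf hx hI => ?_) (fun s' hf hx hI => hI)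
  · simp [IndexExpr.eval, hf.var 0 (by decide), hf.var 1 (by decide)]
  · simp [Store.writeVar]
  · have e0 := hf.num 0 (by decide)
    have e5 := hf.num 5 (by decide)
    refine WP.cond (fun h => WP.of_effect rfl ?_) (fun h => WP.of_effect rfl ?_) <;>
      simp only [Test.Holds, IndexExpr.eval, hx, e0, e5, h5, not_le] at h <;>
      simp [Program.effect, IndexExpr.eval, NumOp.eval, Store.writeVar, Store.writeNum, hx, e0,
        Finset.sum_range_succ, ← add_assoc, ← hI]
    · rw [abs_of_nonneg h]
    · rw [abs_of_neg h, sub_eq_add_neg]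

theorem largeSlack_spec :
    WP n largeSlack s fun s' => s'.num 6 0 = 3 * s.num 3 0 + 1 := by
  refine WP.of_effect rfl ?_
  simp [largeSlack, Program.effect, IndexExpr.eval, Store.writeNum, NumOp.eval]
  ring

/-- The initial slacks. -/
noncomputable def initialSlack (s : Store) (x : ℕ) : ℝ :=
  if x < s.var 0 * s.var 1 then if 0 < s.cell 0 x then s.num 3 0 - s.num 0 x else s.num 6 0
  else s.num 2 x

theorem initSlack_spec (h1 : s.var 1 ≤ n) :
    WP n initSlack s fun s' =>
      ∀ x < s.var 1 * s.var 1, s'.num 2 x = initialSlack s x := by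
  refine WP.for (fun i s' => ∀ x, s'.num 2 x = if x < i then initialSlack s x else s.num 2 x)
    (s.var 1 * s.var 1) (by nlinarith) (by decide) (fun s' hf => ?_) ?_
    (fun i s' hi hf hx hI => ?_) (fun s' hf hx hI x hx' => by rw [hI, if_pos hx'])
  · simp [IndexExpr.eval, hf.var 1 (by decide)]
  · simp [Store.writeVar]
  · have e0 := hf.num 0 (by decide)
    have e3 := hf.num 3 (by decide)
    have e6 := hf.num 6 (by decide)
    have c0 := hf.cell 0 (by decide)
    have v0 := hf.var 0 (by decide)
    have v1 := hf.var 1 (by decide)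
    have key : ∀ {f : ℕ → ℝ}, f i = initialSlack s i → (∀ x, x ≠ i → f x = s'.num 2 x) →
        ∀ x, f x = if x < i + 1 then initialSlack s x else s.num 2 x := by
      intro f h1 h2 x
      rcases lt_trichotomy x i with h | rfl | h
      · rw [h2 x h.ne, hI, if_pos h, if_pos (by omega)]
      · rw [h1, if_pos (by omega)]
      · rw [h2 x h.ne', hI, if_neg (by omega), if_neg (by omega)]
    refine WP.cond (fun h => WP.cond (fun h' => WP.of_effect rfl (key ?_ fun x hxi => ?_))
      fun h' => WP.of_effect rfl (key ?_ fun x hxi => ?_))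
      fun h => WP.of_effect rfl (key ?_ fun x hxi => rfl)
    all_goals simp only [Test.Holds, IndexExpr.eval, hx, v0, v1] at h
    · simp only [Test.Holds, IndexExpr.eval, hx, c0] at h'
      simp [Program.effect, IndexExpr.eval, NumOp.eval, Store.writeVar, Store.writeNum, hx, e0, e3,
        initialSlack, h, h']
    · simp [Program.effect, IndexExpr.eval, Store.writeVar, Store.writeNum, hx, hxi]
    · simp only [Test.Holds, IndexExpr.eval, hx, c0] at h'
      simp [Program.effect, IndexExpr.eval, Store.writeVar, Store.writeNum, hx, e6,
        initialSlack, h, h']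
    · simp [Program.effect, IndexExpr.eval, Store.writeVar, Store.writeNum, hx, hxi]
    · simp [Program.effect, Store.writeVar, hI, initialSlack, h]

/-- Among the pairs in `V`, a pair of a row in `S` and a column outside `T` with minimal slack is
`(i₀, j₀)`, or there are no such pairs. -/
structure IsMinSlack (m : ℕ) (c : ℕ → ℝ) (S T : ℕ → ℕ) (V : ℕ → ℕ → Prop) (found i₀ j₀ : ℕ)
    (δ : ℝ) : Prop where
  mem : 0 < found → i₀ < m ∧ j₀ < m ∧ 0 < S i₀ ∧ T j₀ = 0 ∧ c (i₀ * m + j₀) = δ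
  min : ∀ i j, V i j → 0 < S i → T j = 0 → 0 < found ∧ δ ≤ c (i * m + j)

/-- The flag in variable `7` stands for an infinite minimum: the stored slack is meaningless until
it is set. The set of visited pairs may grow only by the current pair. -/
theorem minSearchStep_spec {S T : ℕ → ℕ} {c : ℕ → ℝ} {m : ℕ} {V V' : ℕ → ℕ → Prop}
    (hm : s.var 1 = m) (hc : s.num 2 = c) (hS : s.cell 2 = S) (hT : s.cell 3 = T)
    (hi : s.var 3 < m) (hj : s.var 4 < m)
    (hI : IsMinSlack m c S T V (s.var 7) (s.var 5) (s.var 6) (s.num 4 0))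
    (hV : ∀ i j, V' i j → V i j ∨ (i = s.var 3 ∧ j = s.var 4)) :
    WP n minSearchStep s fun s' =>
      IsMinSlack m c S T V' (s'.var 7) (s'.var 5) (s'.var 6) (s'.num 4 0) := by
  subst hm hc hS hT
  refine WP.cond (fun h => WP.of_effect rfl ?_) (fun h => WP.of_effect rfl ?_) <;>
    simp only [Test.Holds, position, IndexExpr.eval] at h
  · obtain ⟨⟨h1, h2⟩, h3⟩ := h
    simp only [position, Program.effect, IndexExpr.eval, Store.writeNum, Function.update_apply]
    simp only [if_true]
    refine ⟨fun _ => ⟨hi, hj, h1, by simpa using h2, by simp⟩, fun i j hij hSi hTj => ⟨by simp, ?_⟩⟩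
    rcases hV i j hij with hij | ⟨rfl, rfl⟩
    · obtain ⟨h4, h5⟩ := hI.min i j hij hSi hTj
      simp only [not_and, not_le] at h3
      simpa using (h3 h4).le.trans h5
    · simp
  · refine ⟨hI.mem, fun i j hij hSi hTj => ?_⟩
    rcases hV i j hij with hij | ⟨rfl, rfl⟩
    · exact hI.min i j hij hSi hTj
    · by_contra hcon
      exact h ⟨⟨hSi, by omega⟩, hcon⟩

theorem minSearch_spec (h1 : s.var 1 ≤ n)
    (hex : ∃ i < s.var 1, ∃ j < s.var 1, 0 < s.cell 2 i ∧ s.cell 3 j = 0) :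
    WP n minSearch s fun s' =>
      s'.var 5 < s.var 1 ∧ s'.var 6 < s.var 1 ∧ 0 < s.cell 2 (s'.var 5) ∧
      s.cell 3 (s'.var 6) = 0 ∧ s.num 2 (s'.var 5 * s.var 1 + s'.var 6) = s'.num 4 0 ∧
      ∀ i < s.var 1, ∀ j < s.var 1, 0 < s.cell 2 i → s.cell 3 j = 0 →
        s'.num 4 0 ≤ s.num 2 (i * s.var 1 + j) := by
  refine WP.seq (WP.mono (Q := fun s' => s'.var 7 = 0) (WP.of_effect rfl (by
    simp [Program.effect, IndexExpr.eval])) fun s₀ hf₀ h7 => ?_)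
  have hm₀ : s₀.var 1 = s.var 1 := hf₀.var 1 (by decide)
  have hc₀ : s₀.num 2 = s.num 2 := hf₀.num 2 (by decide)
  have hS₀ : s₀.cell 2 = s.cell 2 := hf₀.cell 2 (by decide)
  have hT₀ : s₀.cell 3 = s.cell 3 := hf₀.cell 3 (by decide)
  refine WP.for (fun i s' => IsMinSlack (s.var 1) (s.num 2) (s.cell 2) (s.cell 3)
      (fun i' j' => i' < i ∧ j' < s.var 1) (s'.var 7) (s'.var 5) (s'.var 6) (s'.num 4 0))
    (s.var 1) (by nlinarith) (by decide) (fun s' hf => ?_) ?_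
    (fun i s₁ hi hf₁ hx₁ hI₁ => ?_) (fun s' hf hx hI => ?_)
  · simp [IndexExpr.eval, hf.var 1 (by decide), hm₀]
  · exact ⟨fun h => by simp [Store.writeVar, h7] at h, fun i j h => by omega⟩
  -- The visited pairs are those lexicographically before `(i, j)`.
  · refine WP.for (fun j s' => IsMinSlack (s.var 1) (s.num 2) (s.cell 2) (s.cell 3)
        (fun i' j' => (i' < i ∧ j' < s.var 1) ∨ (i' = i ∧ j' < j))
        (s'.var 7) (s'.var 5) (s'.var 6) (s'.num 4 0))
      (s.var 1) (by nlinarith) (by decide) (fun s' hf => ?_) ?_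
      (fun j s₂ hj hf₂ hx₂ hI₂ => ?_) (fun s' hf hx hI => ?_)
    · simp [IndexExpr.eval, hf.var 1 (by decide), hf₁.var 1 (by decide), hm₀]
    · exact ⟨hI₁.mem, fun i' j' h => hI₁.min i' j' (by omega)⟩
    · have hx₂' : s₂.var 3 = i := (hf₂.var 3 (by decide)).trans hx₁
      refine (minSearchStep_spec (((hf₂.var 1 (by decide)).trans (hf₁.var 1 (by decide))).trans hm₀)
        (((hf₂.num 2 (by decide)).trans (hf₁.num 2 (by decide))).trans hc₀)
        (((hf₂.cell 2 (by decide)).trans (hf₁.cell 2 (by decide))).trans hS₀)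
        (((hf₂.cell 3 (by decide)).trans (hf₁.cell 3 (by decide))).trans hT₀)
        (by omega) (by omega) hI₂ (V' := fun i' j' => (i' < i ∧ j' < s.var 1) ∨
          (i' = i ∧ j' < j + 1)) fun i' j' h => by omega).mono fun s' _ h => ?_
      simpa [Store.writeVar] using h
    · exact ⟨by simpa [Store.writeVar] using hI.mem, fun i' j' h => by
        simpa [Store.writeVar] using hI.min i' j' (by omega)⟩
  · obtain ⟨i, hi, j, hj, hSi, hTj⟩ := hex
    obtain ⟨g1, g2, g3, g4, g5⟩ := hI.mem (hI.min i j ⟨hi, hj⟩ hSi hTj).1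
    exact ⟨g1, g2, g3, g4, g5, fun i hi j hj hSi hTj => (hI.min i j ⟨hi, hj⟩ hSi hTj).2⟩

theorem changeSlackStep_spec :
    WP n changeSlackStep s fun s' => ∀ x, s'.num 2 x = s.num 2 x +
      if x = s.var 3 * s.var 1 + s.var 4 then
        slackChange (s.cell 2) (s.cell 3) (s.num 4 0) (s.var 3) (s.var 4) else 0 := by
  refine WP.cond (fun h => WP.cond (fun h' => WP.of_effect rfl fun x => ?_)
    fun h' => WP.of_effect rfl fun x => ?_) (fun h => WP.cond (fun h' => WP.of_effect rfl fun x => ?_)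
    fun h' => WP.of_effect rfl fun x => ?_)
  all_goals
    simp only [Test.Holds, IndexExpr.eval] at h h'
    by_cases hx : x = s.var 3 * s.var 1 + s.var 4
    · simp [position, Program.effect, IndexExpr.eval, NumOp.eval, Store.writeNum, slackChange, hx,
        h, h', sub_eq_add_neg]
    · simp [position, Program.effect, IndexExpr.eval, NumOp.eval, Store.writeNum, hx]

theorem changeSlack_spec (h1 : s.var 1 ≤ n) :
    WP n changeSlack s fun s' => ∀ i < s.var 1, ∀ j < s.var 1,
      s'.num 2 (i * s.var 1 + j) = s.num 2 (i * s.var 1 + j) +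
        slackChange (s.cell 2) (s.cell 3) (s.num 4 0) i j := by
  refine WP.for (fun i s' => ∀ i' < s.var 1, ∀ j' < s.var 1,
      s'.num 2 (i' * s.var 1 + j') = s.num 2 (i' * s.var 1 + j') +
        if i' < i then slackChange (s.cell 2) (s.cell 3) (s.num 4 0) i' j' else 0)
    (s.var 1) (by nlinarith) (by decide) (fun s' hf => ?_) ?_
    (fun i s₁ hi hf₁ hx₁ hI₁ => ?_) (fun s' hf hx hI i hi j hj => ?_)
  · simp [IndexExpr.eval, hf.var 1 (by decide)]
  · simp [Store.writeVar]
  · refine WP.for (fun j s' => ∀ i' < s.var 1, ∀ j' < s.var 1,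
        s'.num 2 (i' * s.var 1 + j') = s.num 2 (i' * s.var 1 + j') +
          if i' < i ∨ (i' = i ∧ j' < j) then
            slackChange (s.cell 2) (s.cell 3) (s.num 4 0) i' j' else 0)
      (s.var 1) (by nlinarith) (by decide) (fun s' hf => ?_) ?_
      (fun j s₂ hj hf₂ hx₂ hI₂ => ?_) (fun s' hf hx hI i' hi' j' hj' => ?_)
    · simp [IndexExpr.eval, hf.var 1 (by decide), hf₁.var 1 (by decide)]
    · simpa [Store.writeVar] using hI₁
    · have e1 : s₂.var 1 = s.var 1 := (hf₂.var 1 (by decide)).trans (hf₁.var 1 (by decide))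
      have e2 : s₂.cell 2 = s.cell 2 := (hf₂.cell 2 (by decide)).trans (hf₁.cell 2 (by decide))
      have e3 : s₂.cell 3 = s.cell 3 := (hf₂.cell 3 (by decide)).trans (hf₁.cell 3 (by decide))
      have e4 : s₂.num 4 = s.num 4 := (hf₂.num 4 (by decide)).trans (hf₁.num 4 (by decide))
      have hx₂' : s₂.var 3 = i := (hf₂.var 3 (by decide)).trans hx₁
      refine changeSlackStep_spec.mono fun s' _ h i' hi' j' hj' => ?_
      rw [e1, e2, e3, e4, hx₂', hx₂] at h
      have h' := h (i' * s.var 1 + j')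
      -- Distinct pairs occupy distinct positions, so each slack is changed exactly once.
      simp only [hI₂ i' hi' j' hj', mul_add_inj hj' hj] at h'
      simp only [Store.writeVar]
      rw [h', add_assoc]
      congr 1
      by_cases h4 : i' = i ∧ j' = j
      · rw [if_neg (by omega), if_pos h4, if_pos (by omega), h4.1, h4.2, zero_add]
      · rw [if_neg h4, add_zero]
        congr 1
        simp only [eq_iff_iff]
        omega
    · have := hI i' hi' j' hj'
      simp only [Store.writeVar]
      rw [this]
      congr 2
      simp only [eq_iff_iff]
      omega
  · rw [hI i hi j hj, if_pos hi]

end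

/-! ### Matching the rows one by one -/

section

variable {n m k l : ℕ} {c₀ : ℕ → ℝ} {s : Store}

/-- The state of the machine while the tree of the row `k` has `l` columns. -/
structure Growing (m k l : ℕ) (c₀ : ℕ → ℝ) (s : Store) : Prop where
  var : s.var 8 = 0
  slack : IsSlack m c₀ (s.num 2)
  matching : IsMatching m k (s.num 2) (s.cell 5) (s.cell 6)
  tree : ∃ rank, IsTree m k l (s.num 2) (s.cell 2) (s.cell 3) (s.cell 4) (s.cell 5) (s.cell 6) rank

/-- The state of the machine when the tree of the row `k` has reached a free column. -/
structure Grown (m k : ℕ) (c₀ : ℕ → ℝ) (s : Store) : Prop where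
  var : s.var 8 = 1
  slack : IsSlack m c₀ (s.num 2)
  augmentation : ∃ rank, (∀ i < m, 0 < s.cell 2 i → rank i ≤ m) ∧
    IsAugmentation m k (s.num 2) (s.cell 2) (s.cell 4) (s.cell 5) (s.cell 6) rank (s.var 6)

theorem grow_spec (h : Growing m k l c₀ s) (hi : s.var 5 < m) (hj : s.var 6 < m)
    (hS : 0 < s.cell 2 (s.var 5)) (hT : s.cell 3 (s.var 6) = 0)
    (hc : s.num 2 (s.var 5 * m + s.var 6) = 0) :
    WP n grow s fun s' => Growing m k (l + 1) c₀ s' ∨ Grown m k c₀ s' := by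
  obtain ⟨rank, ht⟩ := h.tree
  refine WP.seq (WP.mono (Q := fun s' => s' = s.writeCell 4 (s.var 6) (s.var 5))
    (WP.of_effect rfl rfl) fun s' _ hs' => ?_)
  subst hs'
  refine WP.cond (fun h' => WP.of_effect rfl (Or.inl ?_)) fun h' => WP.of_effect rfl (Or.inr ?_)
  · simp only [Test.Holds, IndexExpr.eval, Store.writeCell] at h'
    have h'' : 0 < s.cell 6 (s.var 6) := by simpa using h'
    have := ht.grow h.matching hi hj hS hT hc h''
    refine ⟨h.var, h.slack, ?_,
      Function.update rank (s.cell 6 (s.var 6) - 1) (l + 1), ?_⟩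
    · simpa [Program.effect, IndexExpr.eval, Store.writeCell] using h.matching
    · simpa [Program.effect, IndexExpr.eval, Store.writeCell] using this
  · simp only [Test.Holds, IndexExpr.eval, Store.writeCell] at h'
    have h'' : s.cell 6 (s.var 6) = 0 := by simpa using h'
    have := ht.isAugmentation h.matching hi hj hS hc h''
    refine ⟨by simp [Program.effect, IndexExpr.eval], h.slack, rank, ?_, ?_⟩
    · intro i hi hSi
      exact (ht.rank_le i hi (by simpa [Program.effect, Store.writeCell] using hSi)).trans ht.le
    · simpa [Program.effect, IndexExpr.eval, Store.writeCell] using this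

theorem growTree_spec (hn : m ≤ n) (hm : s.var 1 = m) (hk : k < m) (h : Growing m k 0 c₀ s) :
    WP n growTree s (Grown m k c₀) := by
  -- Every iteration adds a column to the tree or stops. A tree has at most `m` columns, so `m + 1`
  -- iterations suffice.
  refine WP.loop (fun l s' => Growing m k l c₀ s' ∨ Grown m k c₀ s') (m + 1) (by nlinarith)
    (Or.inl h) (fun l s₁ hf₁ hI hb => ?_) fun l s₁ hf₁ hI hb => ?_
  · have hI : Growing m k l c₀ s₁ := by
      rcases hI with hI | hI
      · exact hI
      · simp [Test.Holds, IndexExpr.eval, hI.var] at hb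
    have hm₁ : s₁.var 1 = m := (hf₁.var 1 (by decide)).trans hm
    obtain ⟨rank, ht⟩ := hI.tree
    refine ⟨Nat.lt_succ_of_le ht.le, WP.seq ((minSearch_spec (by omega) ?_).mono
      fun s₂ hf₂ h₂ => WP.seq ((changeSlack_spec (by rw [hf₂.var 1 (by decide)]; omega)).mono
        fun s₃ hf₃ h₃ => ?_))⟩
    · obtain ⟨j, hj, hTj⟩ := ht.exists_column hI.matching hk
      exact ⟨k, by omega, j, by omega, ht.root, hTj⟩
    · rw [hm₁] at h₂
      obtain ⟨hi, hj, hS, hT, hc, hmin⟩ := h₂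
      rw [hf₂.var 1 (by decide), hm₁, hf₂.num 2 (by decide), hf₂.cell 2 (by decide),
        hf₂.cell 3 (by decide)] at h₃
      have e2 : s₃.cell 2 = s₁.cell 2 := (hf₃.cell 2 (by decide)).trans (hf₂.cell 2 (by decide))
      have e3 : s₃.cell 3 = s₁.cell 3 := (hf₃.cell 3 (by decide)).trans (hf₂.cell 3 (by decide))
      have e4 : s₃.cell 4 = s₁.cell 4 := (hf₃.cell 4 (by decide)).trans (hf₂.cell 4 (by decide))
      have e5 : s₃.cell 5 = s₁.cell 5 := (hf₃.cell 5 (by decide)).trans (hf₂.cell 5 (by decide))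
      have e6 : s₃.cell 6 = s₁.cell 6 := (hf₃.cell 6 (by decide)).trans (hf₂.cell 6 (by decide))
      have v5 : s₃.var 5 = s₂.var 5 := hf₃.var 5 (by decide)
      have v6 : s₃.var 6 = s₂.var 6 := hf₃.var 6 (by decide)
      have v8 : s₃.var 8 = s₁.var 8 := (hf₃.var 8 (by decide)).trans (hf₂.var 8 (by decide))
      have hδ : 0 ≤ s₂.num 4 0 := by
        rw [← hc]
        exact hI.slack.nonneg _ hi _ hj
      refine grow_spec ⟨v8.trans hI.var, hI.slack.change hδ hmin h₃, ?_, rank, ?_⟩ ?_ ?_ ?_ ?_ ?_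
      · rw [e5, e6]
        exact hI.matching.change ht hk h₃
      · rw [e2, e3, e4, e5, e6]
        exact ht.change hI.matching h₃
      · rwa [v5]
      · rwa [v6]
      · rwa [e2, v5]
      · rwa [e3, v6]
      -- The chosen pair attains the minimum `δ` and loses exactly `δ`, so its slack becomes zero.
      · rw [v5, v6, h₃ _ hi _ hj, hc, slackChange, if_pos hS, if_neg (by omega)]
        ring
  · rcases hI with hI | hI
    · simp [Test.Holds, IndexExpr.eval, hI.var] at hb
    · exact hI

theorem augmentStep_spec {rank : ℕ → ℕ} (hk : s.var 2 = k) (hv : s.var 8 = 0)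
    (h : IsAugmentation m k (s.num 2) (s.cell 2) (s.cell 4) (s.cell 5) (s.cell 6) rank (s.var 6)) :
    WP n augmentStep s fun s' =>
      (s'.var 8 = 0 ∧ IsAugmentation m k (s'.num 2) (s'.cell 2) (s'.cell 4) (s'.cell 5) (s'.cell 6)
        rank (s'.var 6) ∧ rank (s'.cell 4 (s'.var 6)) < rank (s.cell 4 (s.var 6))) ∨
      (s'.var 8 = 1 ∧ IsMatching m (k + 1) (s'.num 2) (s'.cell 5) (s'.cell 6)) := by
  subst hk
  refine WP.seq (WP.of_effect rfl (WP.seq (WP.of_effect rfl (WP.seq (WP.of_effect rfl (WP.seq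
    (WP.of_effect rfl (WP.cond (fun h' => WP.of_effect rfl (Or.inl ?_))
    fun h' => WP.of_effect rfl (Or.inr ?_))))))))) <;>
  simp [Program.effect, Test.Holds, IndexExpr.eval, Store.writeCell] at h'
  · simpa [Program.effect, IndexExpr.eval, Store.writeCell, hv] using h.next h'
  · simpa [Program.effect, IndexExpr.eval, Store.writeCell] using h.isMatching (not_lt.2 h')

theorem augment_spec (hn : m ≤ n) (hk : s.var 2 = k) (h : Grown m k c₀ s) :
    WP n augment s fun s' =>
      IsMatching m (k + 1) (s'.num 2) (s'.cell 5) (s'.cell 6) := by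
  obtain ⟨rank, hrank, haug⟩ := h.augmentation
  -- The rank of the current predecessor starts at most at `m` and drops with every step, which
  -- bounds the length of the path.
  refine WP.seq (WP.of_effect rfl (WP.loop (fun l s' => (s'.var 8 = 0 ∧
      IsAugmentation m k (s'.num 2) (s'.cell 2) (s'.cell 4) (s'.cell 5) (s'.cell 6)
        rank (s'.var 6) ∧ rank (s'.cell 4 (s'.var 6)) + l ≤ m) ∨
      (s'.var 8 = 1 ∧ IsMatching m (k + 1) (s'.num 2) (s'.cell 5) (s'.cell 6))) (m + 1)
    (by nlinarith) (Or.inl ⟨?_, ?_, ?_⟩) (fun l s₁ hf₁ hI hb => ?_) fun l s₁ hf₁ hI hb => ?_))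
  · simp [Program.effect, IndexExpr.eval]
  · simpa [Program.effect, IndexExpr.eval] using haug
  · simpa [Program.effect] using hrank _ haug.parent.lt haug.parent.mem
  · rcases hI with ⟨h8, haug₁, hl⟩ | hI
    · refine ⟨by omega, (augmentStep_spec ((hf₁.var 2 (by decide)).trans (by
        simpa [Program.effect] using hk)) h8 haug₁).mono fun s₂ _ h₂ => ?_⟩
      rcases h₂ with ⟨h8', h₂, hlt⟩ | h₂
      · exact Or.inl ⟨h8', h₂, by omega⟩
      · exact Or.inr h₂
    · simp [Test.Holds, IndexExpr.eval, hI.1] at hb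
  · rcases hI with hI | hI
    · simp [Test.Holds, IndexExpr.eval, hI.1] at hb
    · exact hI.2

theorem initTree_spec (hn : m ≤ n) (hm : s.var 1 = m) (hk : k < m) (hk' : s.var 2 = k)
    (hs : IsSlack m c₀ (s.num 2)) (hM : IsMatching m k (s.num 2) (s.cell 5) (s.cell 6)) :
    WP n initTree s (Growing m k 0 c₀) := by
  refine WP.seq ((WP.for (Q := fun s' => ∀ j < m, s'.cell 2 j = 0 ∧ s'.cell 3 j = 0)
    (fun i s' => ∀ j < i, s'.cell 2 j = 0 ∧ s'.cell 3 j = 0) m (by nlinarith) (by decide)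
    (fun s' hf => ?_) (fun j hj => by omega) (fun i s₁ hi hf hx hI => ?_)
    (fun s' hf hx hI => hI)).mono fun s₁ hf₁ h₁ => WP.of_effect rfl ?_)
  · simp [IndexExpr.eval, hf.var 1 (by decide), hm]
  · refine WP.of_effect rfl fun j hj => ?_
    by_cases h : j = i
    · simp [Program.effect, IndexExpr.eval, Store.writeCell, Store.writeVar, hx, h]
    · simpa [Program.effect, IndexExpr.eval, Store.writeCell, Store.writeVar, hx, h] using
        hI j (by omega)
  · have v2 : s₁.var 2 = k := (hf₁.var 2 (by decide)).trans hk'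
    have n2 : s₁.num 2 = s.num 2 := hf₁.num 2 (by decide)
    have c5 : s₁.cell 5 = s.cell 5 := hf₁.cell 5 (by decide)
    have c6 : s₁.cell 6 = s.cell 6 := hf₁.cell 6 (by decide)
    have hS : ∀ i < m, 0 < Function.update (s₁.cell 2) k 1 i → i = k := by
      intro i hi hSi
      by_contra hne
      rw [Function.update_of_ne hne, (h₁ i hi).1] at hSi
      exact lt_irrefl 0 hSi
    -- The initial tree consists of the root alone, so rank $0$ everywhere is admissible.
    have ht : IsTree m k 0 (s.num 2) (Function.update (s₁.cell 2) k 1) (s₁.cell 3) (s₁.cell 4)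
        (s.cell 5) (s.cell 6) 0 := by
      refine ⟨by simp, fun i hi hSi => (hS i hi hSi).le, fun j hj hTj => ?_, fun i hi hSi => ?_,
        fun i hi hSi => ?_, fun i _ _ => le_rfl, ?_⟩
      · rw [(h₁ j hj).2] at hTj
        exact absurd hTj (lt_irrefl 0)
      · have := hS i (by omega) hSi
        omega
      · have := hS i (by omega) hSi
        omega
      · rw [Finset.card_eq_zero, Finset.filter_eq_empty_iff]
        intro j hj
        rw [(h₁ j (Finset.mem_range.1 hj)).2]
        exact lt_irrefl 0
    refine ⟨by simp [Program.effect, IndexExpr.eval], ?_, ?_, 0, ?_⟩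
    · simpa [Program.effect, IndexExpr.eval, Store.writeCell, n2] using hs
    · simpa [Program.effect, IndexExpr.eval, Store.writeCell, n2, c5, c6] using hM
    · simpa [Program.effect, IndexExpr.eval, Store.writeCell, n2, c5, c6, v2] using ht

theorem matchRows_spec (hn : m ≤ n) (hm : s.var 1 = m)
    (hs : ∀ i < m, ∀ j < m, 0 ≤ s.num 2 (i * m + j)) (hrow : ∀ j < m, s.cell 6 j = 0) :
    WP n matchRows s fun s' => ∃ σ : Equiv.Perm (Fin m), (∀ i, (σ i : ℕ) = s'.cell 5 i) ∧
      ∀ τ : Equiv.Perm (Fin m),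
        ∑ i : Fin m, s.num 2 (i * m + σ i) ≤ ∑ i : Fin m, s.num 2 (i * m + τ i) := by
  refine WP.for (fun k s' => IsSlack m (s.num 2) (s'.num 2) ∧
      IsMatching m k (s'.num 2) (s'.cell 5) (s'.cell 6)) m (by nlinarith) (by decide)
    (fun s' hf => ?_) ⟨⟨hs, 0, fun σ => ?_⟩, ?_⟩ (fun k s₁ hk hf hx hI => ?_)
    (fun s' hf hx hI => hI.2.exists_perm hI.1)
  · simp [IndexExpr.eval, hf.var 1 (by decide), hm]
  · simp [Store.writeVar]
  · refine ⟨by simp, by simp, fun j hj hr => ?_, by simp⟩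
    simp only [Store.writeVar, hrow j hj] at hr
    exact absurd hr (lt_irrefl 0)
  · refine WP.seq ((initTree_spec hn ((hf.var 1 (by decide)).trans hm) hk hx hI.1 hI.2).mono
      fun s₂ hf₂ h₂ => WP.seq ((growTree_spec hn ?_ hk h₂).mono
        fun s₃ hf₃ h₃ => (augment_spec hn ?_ h₃).mono fun s₄ hf₄ h₄ => ⟨?_, h₄⟩))
    · exact ((hf₂.var 1 (by decide)).trans (hf.var 1 (by decide))).trans hm
    · exact ((hf₃.var 2 (by decide)).trans (hf₂.var 2 (by decide))).trans hx
    · have := h₃.slack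
      rwa [← hf₄.num 2 (by decide)] at this

/-- The flag in index array `1` is set once before the loop and can only be cleared inside it, so a
single entry $-\infty$ makes the output $-\infty$. The sum runs over the $d$ genuine rows only. -/
theorem sumMatched_spec (h0 : s.var 0 ≤ n) (h1 : s.num 1 0 = 0) :
    WP n sumMatched s fun s' => output s' = ∑ i ∈ Finset.range (s.var 0),
      if 0 < s.cell 0 (i * s.var 1 + s.cell 5 i) then
        ((s.num 0 (i * s.var 1 + s.cell 5 i) : ℝ) : WithBot ℝ) else ⊥ := by
  refine WP.seq (WP.of_effect rfl ?_)
  refine WP.for (fun k s' => output s' = ∑ i ∈ Finset.range k,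
      if 0 < s.cell 0 (i * s.var 1 + s.cell 5 i) then
        ((s.num 0 (i * s.var 1 + s.cell 5 i) : ℝ) : WithBot ℝ) else ⊥) (s.var 0) (by nlinarith)
    (by decide) (fun s' hf => ?_) ?_ (fun k s₁ hk hf hx hI => ?_) (fun s' hf hx hI => hI)
  · simp [IndexExpr.eval, hf.var 0 (by decide), Program.effect, Store.writeCell]
  · simp [Store.writeVar, output, Program.effect, IndexExpr.eval, Store.writeCell, h1]
  · have v1 : s₁.var 1 = s.var 1 := hf.var 1 (by decide)
    have n0 : s₁.num 0 = s.num 0 := hf.num 0 (by decide)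
    have c0 : s₁.cell 0 = s.cell 0 := (hf.cell 0 (by decide)).trans (by
      simp [Program.effect, Store.writeCell])
    have c5 : s₁.cell 5 = s.cell 5 := (hf.cell 5 (by decide)).trans (by
      simp [Program.effect, Store.writeCell])
    refine WP.cond (fun h => WP.of_effect rfl ?_) (fun h => WP.of_effect rfl ?_) <;>
      rw [Finset.sum_range_succ, ← hI] <;>
      simp only [Test.Holds, position, IndexExpr.eval, hx, v1, c0, c5] at h
    · rw [if_pos h]
      by_cases h' : s₁.cell 1 0 = 0
      · simp [Program.effect, IndexExpr.eval, Store.writeVar, Store.writeNum, output, h']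
      · simp [position, Program.effect, IndexExpr.eval, Store.writeVar, Store.writeNum, NumOp.eval,
          output, h', hx, v1, n0, c5]
    · rw [if_neg h, WithBot.add_bot]
      simp [Program.effect, IndexExpr.eval, Store.writeVar, Store.writeCell, output]

end

/-! ### The assignment problem with entries `-∞` -/

section

variable {d m : ℕ} {A : Matrix (Fin d) (Fin m) (WithBot ℝ)}

theorem entry_mul_add (A : Matrix (Fin d) (Fin m) (WithBot ℝ)) (i : Fin d) (j : Fin m) :
    entry A (i * m + j) = A i j := by
  have h : (i : ℕ) * m + j < d * m := by
    calc (i : ℕ) * m + j < i * m + m := Nat.add_lt_add_left j.2 _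
      _ = (i + 1) * m := by ring
      _ ≤ d * m := Nat.mul_le_mul_right _ i.2
  have h' : finProdFinEquiv.symm ⟨(i : ℕ) * m + j, h⟩ = (i, j) := by
    rw [Equiv.symm_apply_eq]
    ext
    simp [finProdFinEquiv, mul_comm, add_comm]
  rw [entry, dif_pos h, h']

theorem sum_range_entry (F : WithBot ℝ → ℝ) :
    ∑ x ∈ Finset.range (d * m), F (entry A x) = ∑ i, ∑ j, F (A i j) := by
  rw [Finset.sum_range, ← Equiv.sum_comp finProdFinEquiv, Fintype.sum_prod_type]
  refine Finset.sum_congr rfl fun i _ => Finset.sum_congr rfl fun j _ => ?_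
  rw [← entry_mul_add A i j]
  congr 2
  simp [finProdFinEquiv, mul_comm, add_comm]

/-- The initial slack of an entry, if `M` is the sum of the absolute values of the entries. -/
noncomputable def entrySlack (M : ℝ) (x : WithBot ℝ) : ℝ :=
  x.recBotCoe (3 * M + 1) (fun r => M - r)

theorem abs_sum_le {x : Fin d → Fin m} {M : ℝ} (hM : M = ∑ i, ∑ j, |(A i j).unbotD 0|) :
    |∑ i, (A i (x i)).unbotD 0| ≤ M := by
  rw [hM]
  exact (Finset.abs_sum_le_sum_abs _ _).trans (Finset.sum_le_sum fun i _ =>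
    Finset.single_le_sum (f := fun j => |(A i j).unbotD 0|) (fun j _ => abs_nonneg _)
      (Finset.mem_univ (x i)))

/-- A permutation with minimal slack yields a transversal of maximal weight. -/
theorem sum_le_of_slack_le (hdm : d ≤ m) {M : ℝ} (hM : M = ∑ i, ∑ j, |(A i j).unbotD 0|)
    {c : ℕ → ℝ} (hc : ∀ (i : Fin d) (j : Fin m), c (i * m + j) = entrySlack M (A i j))
    (hc0 : ∀ i < m, d ≤ i → ∀ j < m, c (i * m + j) = 0) {σ : Equiv.Perm (Fin m)}
    (hσ : ∀ τ : Equiv.Perm (Fin m),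
      ∑ i : Fin m, c (i * m + σ i) ≤ ∑ i : Fin m, c (i * m + τ i)) (g : Fin d ↪ Fin m) :
    ∑ i, A i (g i) ≤ ∑ i, A i (σ (Fin.castLE hdm i)) := by
  have hM0 : 0 ≤ M := by
    rw [hM]
    exact Finset.sum_nonneg fun i _ => Finset.sum_nonneg fun j _ => abs_nonneg _
  have hsum : ∀ τ : Equiv.Perm (Fin m), ∑ i : Fin m, c (i * m + τ i) =
      ∑ i : Fin d, entrySlack M (A i (τ (Fin.castLE hdm i))) := by
    intro τ
    refine (Fintype.sum_of_injective (Fin.castLE hdm) (Fin.castLE_injective hdm) _ _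
      (fun i hi => ?_) fun i => (hc i _).symm).symm
    refine hc0 i i.2 ?_ _ (τ i).2
    by_contra hlt
    exact hi ⟨⟨i, not_le.1 hlt⟩, rfl⟩
  -- Any injection of the $d$ rows extends to a permutation of all $m$; the padding rows cost
  -- nothing.
  obtain ⟨τ, hτ⟩ := Equiv.Perm.exists_extending_pair (Fin.castLE hdm) g
    (Fin.castLE_injective hdm) g.injective
  have h := hσ τ
  rw [hsum, hsum] at h
  simp only [hτ] at h
  by_cases hg : ∀ i, A i (g i) ≠ ⊥
  swap
  · push Not at hg
    rw [WithBot.sum_eq_bot_iff.2 (by simpa using hg)]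
    exact bot_le
  have hg' : ∀ i, A i (g i) = ((A i (g i)).unbotD 0 : ℝ) := by
    intro i
    obtain ⟨r, hr⟩ := WithBot.ne_bot_iff_exists.1 (hg i)
    rw [← hr, WithBot.unbotD_coe]
  have hslack : ∀ r : ℝ, entrySlack M (r : WithBot ℝ) = M - r := fun r => rfl
  have hgs : ∑ i, entrySlack M (A i (g i)) = d * M - ∑ i, (A i (g i)).unbotD 0 := by
    rw [Finset.sum_congr rfl fun i _ => by rw [hg' i, hslack], Finset.sum_sub_distrib]
    simp
  by_cases hs : ∀ i, A i (σ (Fin.castLE hdm i)) ≠ ⊥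
  · have hs' : ∀ i, A i (σ (Fin.castLE hdm i)) = ((A i (σ (Fin.castLE hdm i))).unbotD 0 : ℝ) := by
      intro i
      obtain ⟨r, hr⟩ := WithBot.ne_bot_iff_exists.1 (hs i)
      rw [← hr, WithBot.unbotD_coe]
    have hss : ∑ i, entrySlack M (A i (σ (Fin.castLE hdm i))) =
        d * M - ∑ i, (A i (σ (Fin.castLE hdm i))).unbotD 0 := by
      rw [Finset.sum_congr rfl fun i _ => by rw [hs' i, hslack], Finset.sum_sub_distrib]
      simp
    rw [hgs, hss] at h
    rw [Finset.sum_congr rfl fun i _ => hg' i, Finset.sum_congr rfl fun i _ => hs' i,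
      ← WithBot.coe_sum, ← WithBot.coe_sum, WithBot.coe_le_coe]
    linarith
  · exfalso
    push Not at hs
    obtain ⟨i₀, hi₀⟩ := hs
    -- An entry $-\infty$ costs $2M+1$ more than an entry $0$, which is what `unbotD 0` puts in its
    -- place.
    have hle : ∀ i, M - (A i (σ (Fin.castLE hdm i))).unbotD 0 +
        (if i = i₀ then 2 * M + 1 else 0) ≤ entrySlack M (A i (σ (Fin.castLE hdm i))) := by
      intro i
      by_cases hi : i = i₀
      · subst hi
        rw [hi₀, if_pos rfl]
        simp only [WithBot.unbotD_bot, entrySlack, WithBot.recBotCoe_bot]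
        linarith
      · rw [if_neg hi]
        generalize A i (σ (Fin.castLE hdm i)) = x
        induction x using WithBot.recBotCoe with
        | bot =>
          simp only [WithBot.unbotD_bot, entrySlack, WithBot.recBotCoe_bot]
          linarith
        | coe r => simp [hslack]
    have hle' := Finset.sum_le_sum fun i (_ : i ∈ Finset.univ) => hle i
    rw [Finset.sum_add_distrib, Finset.sum_sub_distrib] at hle'
    simp only [Finset.sum_const, Finset.card_univ, Fintype.card_fin, nsmul_eq_mul,
      Finset.sum_ite_eq', Finset.mem_univ, if_true] at hle'
    have h1 := abs_le.1 (abs_sum_le (x := g) hM)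
    have h2 := abs_le.1 (abs_sum_le (x := fun i => σ (Fin.castLE hdm i)) hM)
    -- The finite injection costs at most $dM+M$, whereas a permutation through an entry $-\infty$
    -- costs at least $dM-M+2M+1$; this is the reason for the slack $3M+1$.
    linarith [h1.1, h2.2]

/-! ### Correctness of the program -/

theorem hungarian_spec (A : Matrix (Fin d) (Fin m) (WithBot ℝ)) :
    WP (d + m) hungarian (input A) fun s =>
      (d < m → ∃ f : Fin d ↪ Fin m, output s = ∑ i, A i (f i) ∧
        ∀ g : Fin d ↪ Fin m, ∑ i, A i (g i) ≤ output s) ∧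
      (m ≤ d → output s = ⊥) := by
  have v0 : (input A).var 0 = d := rfl
  have v1 : (input A).var 1 = m := rfl
  refine WP.cond (fun h => ?_) fun h => WP.of_effect rfl ?_
  swap
  · simp only [Test.Holds, IndexExpr.eval, v0, v1] at h
    -- The output flag of the input store is zero, so doing nothing already outputs $-\infty$.
    exact ⟨fun h' => absurd h' h, fun _ => by simp [Program.effect, output, input]⟩
  have hdm : d < m := by simpa only [Test.Holds, IndexExpr.eval, v0, v1] using h
  refine WP.seq ((absSum_spec (by omega) (by omega) rfl).mono fun s₁ hf₁ h₁ => WP.seq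
    (largeSlack_spec.mono fun s₂ hf₂ h₂ => WP.seq ((initSlack_spec (by
      rw [hf₂.var 1 (by decide), hf₁.var 1 (by decide)]; omega)).mono fun s₃ hf₃ h₃ => ?_)))
  set M : ℝ := ∑ i, ∑ j, |(A i j).unbotD 0| with hM
  have hM₁ : s₁.num 3 0 = M := by
    rw [h₁, hM, ← sum_range_entry fun x => |x.unbotD 0|]
    exact zero_add _
  have hvar : ∀ x, x ≠ 3 → s₃.var x = (input A).var x := by
    intro x hx
    rw [hf₃.var x (by simpa [initSlack, Program.for, Program.varWrites] using hx),
      hf₂.var x (by simp [largeSlack, Program.varWrites]),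
      hf₁.var x (by simpa [absSum, Program.for, Program.varWrites] using hx)]
  have hcell : ∀ a, s₃.cell a = (input A).cell a := fun a => by
    rw [hf₃.cell a (by simp [initSlack, Program.for, Program.cellWrites]),
      hf₂.cell a (by simp [largeSlack, Program.cellWrites]),
      hf₁.cell a (by simp [absSum, Program.for, Program.cellWrites])]
  have hn0 : s₃.num 0 = (input A).num 0 :=
    (hf₃.num 0 (by decide)).trans ((hf₂.num 0 (by decide)).trans (hf₁.num 0 (by decide)))
  have hn1 : s₃.num 1 = (input A).num 1 :=
    (hf₃.num 1 (by decide)).trans ((hf₂.num 1 (by decide)).trans (hf₁.num 1 (by decide)))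
  have w1 : s₃.var 1 = m := hvar 1 (by norm_num)
  have hcell0 : ∀ (i : Fin d) (j : Fin m), (input A).cell 0 (i * m + j) =
      if A i j = ⊥ then 0 else 1 := by
    intro i j
    simp only [input, entry_mul_add, true_and, ne_eq]
    by_cases h : A i j = ⊥ <;> simp [h]
  have hnum0 : ∀ (i : Fin d) (j : Fin m), (input A).num 0 (i * m + j) = (A i j).unbotD 0 := by
    intro i j
    simp only [input, entry_mul_add, if_true]
  have hlt : ∀ i < m, ∀ j < m, i * m + j < m * m := by
    intro i hi j hj
    calc i * m + j < i * m + m := Nat.add_lt_add_left hj _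
      _ = (i + 1) * m := by ring
      _ ≤ m * m := Nat.mul_le_mul_right _ hi
  have hslack : ∀ x < m * m, s₃.num 2 x = if x < d * m then
      if 0 < (input A).cell 0 x then M - (input A).num 0 x else 3 * M + 1 else 0 := by
    intro x hx
    have hv0 : s₂.var 0 = d := (hf₂.var 0 (by decide)).trans (hf₁.var 0 (by decide))
    have hv1 : s₂.var 1 = m := (hf₂.var 1 (by decide)).trans (hf₁.var 1 (by decide))
    rw [h₃ x (by rwa [hv1]), initialSlack, hv0, hv1, hf₂.cell 0 (by decide),
      hf₁.cell 0 (by decide), hf₂.num 3 (by decide), hf₂.num 0 (by decide),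
      hf₁.num 0 (by decide), h₂, hM₁, hf₂.num 2 (by decide), hf₁.num 2 (by decide)]
    rfl
  have hc : ∀ (i : Fin d) (j : Fin m), s₃.num 2 (i * m + j) = entrySlack M (A i j) := by
    intro i j
    have hlt' : (i : ℕ) * m + j < d * m := by
      calc (i : ℕ) * m + j < i * m + m := Nat.add_lt_add_left j.2 _
        _ = (i + 1) * m := by ring
        _ ≤ d * m := Nat.mul_le_mul_right _ i.2
    rw [hslack _ (hlt i (i.2.trans hdm) j j.2), if_pos hlt', hcell0, hnum0]
    generalize A i j = x
    induction x using WithBot.recBotCoe with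
    | bot => simp [entrySlack]
    | coe r => simp [entrySlack]
  -- Positions from `d * m` on are not written and keep the zeros of the input store; they form the
  -- padding rows.
  have hc0 : ∀ i < m, d ≤ i → ∀ j < m, s₃.num 2 (i * m + j) = 0 := by
    intro i hi hdi j hj
    rw [hslack _ (hlt i hi j hj), if_neg]
    rw [not_lt]
    exact (Nat.mul_le_mul_right m hdi).trans (Nat.le_add_right _ _)
  have hM0 : 0 ≤ M := Finset.sum_nonneg fun i _ => Finset.sum_nonneg fun j _ => abs_nonneg _
  have hnonneg : ∀ i < m, ∀ j < m, 0 ≤ s₃.num 2 (i * m + j) := by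
    intro i hi j hj
    by_cases hid : i < d
    · rw [hc ⟨i, hid⟩ ⟨j, hj⟩]
      have hle : |(A ⟨i, hid⟩ ⟨j, hj⟩).unbotD 0| ≤ M :=
        (Finset.single_le_sum (f := fun j => |(A ⟨i, hid⟩ j).unbotD 0|)
          (fun j _ => abs_nonneg _) (Finset.mem_univ _)).trans
        (Finset.single_le_sum (f := fun i => ∑ j, |(A i j).unbotD 0|)
          (fun i _ => Finset.sum_nonneg fun j _ => abs_nonneg _) (Finset.mem_univ _))
      generalize A ⟨i, hid⟩ ⟨j, hj⟩ = x at hle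
      induction x using WithBot.recBotCoe with
      | bot =>
        simp only [entrySlack, WithBot.recBotCoe_bot]
        linarith
      | coe r =>
        simp only [entrySlack, WithBot.recBotCoe_coe]
        have := (abs_le.1 hle).2
        rw [WithBot.unbotD_coe] at this
        linarith
    · rw [hc0 i hi (not_lt.1 hid) j hj]
  refine WP.seq ((matchRows_spec (by omega) w1 hnonneg fun j _ => ?_).mono fun s₄ hf₄ h₄ =>
    (sumMatched_spec ?_ ?_).mono fun s₅ _ h₅ => ?_)
  · rw [hcell]
    simp [input]
  · rw [hf₄.var 0 (by decide), hvar 0 (by norm_num), v0]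
    omega
  · rw [hf₄.num 1 (by decide), hn1]
    simp [input]
  obtain ⟨σ, hσ, hmin⟩ := h₄
  have hout : output s₅ = ∑ i, A i (σ (Fin.castLE hdm.le i)) := by
    rw [h₅, hf₄.var 0 (by decide), hvar 0 (by norm_num), v0, hf₄.var 1 (by decide), w1,
      hf₄.cell 0 (by decide), hcell, hf₄.num 0 (by decide), hn0, Finset.sum_range]
    refine Finset.sum_congr rfl fun i _ => ?_
    have hσi : s₄.cell 5 i = σ (Fin.castLE hdm.le i) := (hσ (Fin.castLE hdm.le i)).symm
    rw [hσi, hcell0, hnum0]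
    generalize A i (σ (Fin.castLE hdm.le i)) = x
    induction x using WithBot.recBotCoe with
    | bot => simp
    | coe r => simp
  refine ⟨fun _ => ⟨(Fin.castLEEmb hdm.le).trans σ.toEmbedding, hout, fun g => ?_⟩,
    fun h' => absurd hdm (not_lt.2 h')⟩
  rw [hout]
  exact sum_le_of_slack_le hdm.le hM hc hc0 hmin g

end

end TropVol

/-! ### The main theorem -/

theorem mainTheorem8 :
    ∃ P : TropVol.Program,
      ∀ (L : FirstOrder.Language.{u, v}) [L.Structure ℝ]
        (K : Subring (Filter.Germ (Filter.atTop : Filter ℝ) ℝ)),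
        TropVol.IsDefinableHardyField L K →
          P.ComputesInStronglyPolynomialTime (fun _ _ A => TropVol.qvolPlus K A) := by
  refine ⟨TropVol.hungarian, fun L _ K hK =>
    TropVol.computesInStronglyPolynomialTime_of_isTame TropVol.isTame_hungarian fun d m A =>
      (TropVol.hungarian_spec A).mono fun s _ ⟨hlt, hle⟩ => ?_⟩
  rcases lt_or_ge d m with hdm | hdm
  · obtain ⟨f, hf, hg⟩ := hlt hdm
    -- The output is the maximal weight of an injection. If it is $-\infty$, all injections have
    -- weight $-\infty$ and only the upper bound is needed; a finite maximum also needs the monomial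
    -- lift.
    generalize TropVol.output s = v at hf hg
    induction v using WithBot.recBotCoe with
    | bot => exact (TropVol.qvolPlus_eq_bot fun _ g => le_bot_iff.1 (hg g)).symm
    | coe v => exact (TropVol.qvolPlus_eq_coe hK.rpow_mem hdm f hf.symm hg).symm
  · rw [hle hdm]
    exact (TropVol.qvolPlus_eq_bot fun h => absurd hdm (not_le.2 h)).symm
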